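/- Let $K$ be a field, $S=K[x_1,\dots,x_n]$ with the standard grading and $\mathfrak m=(x_1,\dots,x_n)$, let $M$ be a finitely generated $\mathbb Z$-graded $S$-module, and let $I\subseteq S$ be a homogeneous ideal such that $M/IM$ has Krull dimension $0$ (or is zero). Let $c\ge 0$ be an integer such that $I$ is generated by homogeneous elements of degree $\le c$, and let $v=\dim_K [S/I]_c$ be the dimension of the degree-$c$ component of $S/I$. Let $u_1,\dots,u_r$ be a minimal system of homogeneous generators of $I$, of degrees $d_1,\dots,d_r$; that is, $I=(u_1,\dots,u_r)$ and the kernel of $\varphi:F=\bigoplus_{k=1}^r S(-d_k)\to S$, $e_k\mapsto u_k$, is contained in $\mathfrak mF$. Let $Z_t=Z_t(I,M)$ and $H_t=H_t(I,M)$ be the graded modules of cycles and the homology, in homological degree $t$, of the Koszul complex $\bigwedge^\bullet F\otimes_S M$ of $\varphi$ with coefficients in $M$. For a finitely generated graded $S$-module $N$ let $\operatorname{reg} N=\sup\{\,j-i : \operatorname{Tor}_i^S(N,K)_j\neq 0\,\}$ be its Castelnuovo–Mumford regularity, with $\operatorname{reg} 0=-\infty$. Then for every $t\ge 0$ $$\operatorname{reg}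 Z_t\le t(c+1)+\operatorname{reg} M+v\qquad\text{and}\qquad \operatorname{reg} H_t\le t(c+1)+\operatorname{reg} M+v+c-1 .$$ -/

import Mathlib

namespace KoszulReg

open MvPolynomial

section Koszul

variable {S : Type*} [CommRing S] {r : ℕ}

/-- `K_t = ⋀^t F ⊗ M` for a free module `F` with basis `e_0, …, e_{r-1}`: an element
`∑ e_J ⊗ m_J` is recorded by its family of coefficients `m_J`, where `J` runs over the
`t`-element subsets of the index set. -/
abbrev Chain (r t : ℕ) (M : Type*) : Type _ :=
  {J : Finset (Fin r) // J.card = t} → M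

/-- `J ∪ {k}` for `k ∉ J`. -/
def ins {t : ℕ} (J : {J : Finset (Fin r) // J.card = t}) (k : {k : Fin r // k ∉ J.1}) :
    {J : Finset (Fin r) // J.card = t + 1} :=
  ⟨insert k.1 J.1, by rw [Finset.card_insert_of_notMem k.2, J.2]⟩

/-- The sign `σ({k}, J) = (-1)^#{j ∈ J : k > j}`. -/
def sgn (S : Type*) [CommRing S] (k : Fin r) (J : Finset (Fin r)) : S :=
  (-1) ^ (J.filter (fun j => j < k)).card

/-- The Koszul differential `K_{t+1} → K_t` of the map `φ : F → S`, `φ(e_k) = u_k`, with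
coefficients in `M`, i.e. `∂ (e_A ⊗ m) = ∑_{k ∈ A} σ({k}, A \ {k}) e_{A \ {k}} ⊗ u_k m`;
its coefficient at `e_J` collects the contributions of the sets `A = J ∪ {k}`, `k ∉ J`. -/
def diff (u : Fin r → S) (M : Type*) [AddCommGroup M] [Module S M] (t : ℕ) :
    Chain r (t + 1) M →ₗ[S] Chain r t M where
  toFun f := fun J => ∑ k : {k : Fin r // k ∉ J.1}, (sgn S k.1 J.1 * u k.1) • f (ins J k)
  map_add' f g := by
    funext J
    simp [Finset.sum_add_distrib]
  map_smul' a f := by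
    funext J
    simp only [Pi.smul_apply, RingHom.id_apply, Finset.smul_sum]
    exact Finset.sum_congr rfl fun k _ => smul_comm _ _ _

/-- The Koszul cycles `Z_t(φ, M)`. -/
def cycles (u : Fin r → S) (M : Type*) [AddCommGroup M] [Module S M] :
    (t : ℕ) → Submodule S (Chain r t M)
  | 0 => ⊤
  | t + 1 => LinearMap.ker (diff u M t)

/-- The Koszul boundaries `B_t(φ, M)`. -/
def boundaries (u : Fin r → S) (M : Type*) [AddCommGroup M] [Module S M] (t : ℕ) :
    Submodule S (Chain r t M) :=
  LinearMap.range (diff u M t)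

/-- The Koszul differential squares to zero. -/
theorem diff_diff (u : Fin r → S) (M : Type*) [AddCommGroup M] [Module S M] (t : ℕ)
    (f : Chain r (t + 1 + 1) M) : diff u M t (diff u M (t + 1) f) = 0 := by
  funext J
  simp only [diff, LinearMap.coe_mk, AddHom.coe_mk, Pi.zero_apply, Finset.smul_sum, smul_smul]
  rw [← Finset.univ.sum_sigma' (fun _ => Finset.univ) (fun (k : {k : Fin r // k ∉ J.1})
    (l : {l : Fin r // l ∉ (ins J k).1}) => (sgn S k.1 J.1 * u k.1 *
      (sgn S l.1 (ins J k).1 * u l.1)) • f (ins (ins J k) l)) |>.symm]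
  have hne : ∀ (k : {k : Fin r // k ∉ J.1}) (l : {l : Fin r // l ∉ (ins J k).1}),
      l.1 ≠ k.1 ∧ l.1 ∉ J.1 := by
    intro k l
    have := l.2
    simpa [ins, not_or] using this
  refine Finset.sum_involution
    (fun a _ => ⟨⟨a.2.1, (hne a.1 a.2).2⟩, ⟨a.1.1, by
      have := hne a.1 a.2
      simp only [ins, Finset.mem_insert, not_or]
      exact ⟨this.1.symm, a.1.2⟩⟩⟩) ?_ ?_ ?_ ?_
  · rintro ⟨⟨k, hk⟩, ⟨l, hl⟩⟩ -
    have h := hne ⟨k, hk⟩ ⟨l, hl⟩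
    obtain ⟨h1, h2⟩ := h
    simp only at h1 h2
    have e : insert k (insert l J.1) = insert l (insert k J.1) := Finset.insert_comm _ _ _
    simp only [ins, e]
    rw [← add_smul]
    convert zero_smul S _
    simp only [sgn, Finset.filter_insert]
    rcases lt_or_gt_of_ne h1 with h | h
    · rw [if_neg h.not_gt, if_pos h, Finset.card_insert_of_notMem (by simp [h2])]
      ring
    · rw [if_pos h, if_neg h.not_gt, Finset.card_insert_of_notMem (by simp [hk])]
      ring
  · rintro ⟨⟨k, hk⟩, ⟨l, hl⟩⟩ - - h
    have h1 := (hne ⟨k, hk⟩ ⟨l, hl⟩).1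
    simp only [Sigma.mk.injEq, Subtype.mk.injEq] at h
    exact h1 h.1
  · intros; simp
  · rintro ⟨⟨k, hk⟩, ⟨l, hl⟩⟩ -
    rfl

theorem boundaries_le_cycles (u : Fin r → S) (M : Type*) [AddCommGroup M] [Module S M] (t : ℕ) :
    boundaries u M t ≤ cycles u M t := by
  rintro _ ⟨f, rfl⟩
  cases t with
  | zero => trivial
  | succ t => exact diff_diff u M t f

/-- The Koszul homology `H_t(φ, M) = Z_t(φ, M) / B_t(φ, M)`. -/
abbrev Homology (u : Fin r → S) (M : Type*) [AddCommGroup M] [Module S M] (t : ℕ) : Type _ :=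
  cycles u M t ⧸ (boundaries u M t).comap (cycles u M t).subtype

/-- The internal grading of `Z_t(φ, M)` when `F = ⨁ S(-d_k)`, i.e. `deg e_k = d_k`: the element
`∑ e_J ⊗ m_J` has degree `j` iff every `m_J` has degree `j - ∑_{k ∈ J} d_k`. -/
def cyclesGrading (u : Fin r → S) (d : Fin r → ℕ) {M : Type*} [AddCommGroup M] [Module S M]
    (ℳ : ℤ → AddSubgroup M) (t : ℕ) (j : ℤ) : AddSubgroup (cycles u M t) where
  carrier := {z | ∀ J, z.1 J ∈ ℳ (j - ∑ k ∈ J.1, (d k : ℤ))}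
  zero_mem' := fun J => (ℳ _).zero_mem
  add_mem' := by
    intro x y hx hy J
    exact (ℳ _).add_mem (hx J) (hy J)
  neg_mem' := by
    intro x hx J
    exact (ℳ _).neg_mem (hx J)

/-- The induced internal grading of `H_t(φ, M)`. -/
def homologyGrading (u : Fin r → S) (d : Fin r → ℕ) {M : Type*} [AddCommGroup M] [Module S M]
    (ℳ : ℤ → AddSubgroup M) (t : ℕ) (j : ℤ) : AddSubgroup (Homology u M t) :=
  (cyclesGrading u d ℳ t j).map
    (Submodule.mkQ ((boundaries u M t).comap (cycles u M t).subtype)).toAddMonoidHom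

end Koszul

section Graded

variable (n : ℕ) (K : Type*) [Field K]

/-- `ℳ` makes `M` a `ℤ`-graded module over the standard graded polynomial ring. -/
structure IsGradedModule {M : Type*} [AddCommGroup M] [Module (MvPolynomial (Fin n) K) M]
    (ℳ : ℤ → AddSubgroup M) : Prop where
  isInternal : DirectSum.IsInternal ℳ
  smul_mem : ∀ (i : ℕ) (j : ℤ) (f : MvPolynomial (Fin n) K) (m : M),
    f.IsHomogeneous i → m ∈ ℳ j → f • m ∈ ℳ (i + j)

variable {n K} in
/-- `p` is homogeneous of the (possibly negative) degree `z`; for `z < 0` only `p = 0` is. -/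
def IsHomogeneousInt (p : MvPolynomial (Fin n) K) (z : ℤ) : Prop :=
  ∀ m ∈ p.support, (m.degree : ℤ) = z

/-- A graded free resolution `⋯ → F_1 → F_0 → M → 0` over the polynomial ring `S`, with
`F_i = ⨁_k S(-shift i k)` of finite rank and all maps homogeneous of degree `0`. -/
structure GradedFreeResolution {M : Type*} [AddCommGroup M] [Module (MvPolynomial (Fin n) K) M]
    (ℳ : ℤ → AddSubgroup M) where
  rank : ℕ → ℕ
  shift : (i : ℕ) → Fin (rank i) → ℤ
  d : (i : ℕ) → Matrix (Fin (rank i)) (Fin (rank (i + 1))) (MvPolynomial (Fin n) K)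
  aug : (Fin (rank 0) → MvPolynomial (Fin n) K) →ₗ[MvPolynomial (Fin n) K] M
  d_homogeneous : ∀ i l k, IsHomogeneousInt (d i l k) (shift (i + 1) k - shift i l)
  aug_homogeneous : ∀ k, aug (Pi.single k 1) ∈ ℳ (shift 0 k)
  aug_surjective : Function.Surjective aug
  exact_zero : Function.Exact (d 0).mulVecLin aug
  exact_succ : ∀ i, Function.Exact (d (i + 1)).mulVecLin (d i).mulVecLin

namespace GradedFreeResolution

variable {n K} {M : Type*} [AddCommGroup M] [Module (MvPolynomial (Fin n) K) M]
  {ℳ : ℤ → AddSubgroup M} (F : GradedFreeResolution n K ℳ)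

/-- The differential of `F ⊗_S K`, where `K = S/𝔪`. -/
noncomputable def residueDiff (i : ℕ) : (Fin (F.rank (i + 1)) → K) →ₗ[K] (Fin (F.rank i) → K) :=
  ((F.d i).map constantCoeff).mulVecLin

/-- The cycles of `F ⊗_S K`. -/
noncomputable def residueCycles : (i : ℕ) → Submodule K (Fin (F.rank i) → K)
  | 0 => ⊤
  | i + 1 => LinearMap.ker (F.residueDiff i)

/-- The degree `j` component of `F_i ⊗_S K = ⨁_k K(-shift i k)`. -/
def residueDegree (i : ℕ) (j : ℤ) : Submodule K (Fin (F.rank i) → K) where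
  carrier := {x | ∀ k, F.shift i k ≠ j → x k = 0}
  zero_mem' := fun _ _ => rfl
  add_mem' := fun hx hy k hk => by simp [hx k hk, hy k hk]
  smul_mem' := fun a x hx k hk => by simp [hx k hk]

/-- `Tor_i^S(M, K)_j`: the degree `j` component of the `i`-th homology of `F ⊗_S K`. -/
abbrev Tor (i : ℕ) (j : ℤ) : Type _ :=
  (F.residueCycles i ⊓ F.residueDegree i j : Submodule K (Fin (F.rank i) → K)) ⧸
    (LinearMap.range (F.residueDiff i)).comap (F.residueCycles i ⊓ F.residueDegree i j).subtype

/-- The graded Betti number `β_{i,j}(M) = dim_K Tor_i^S(M, K)_j`. -/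
noncomputable def betti (i : ℕ) (j : ℤ) : ℕ :=
  Module.finrank K (F.Tor i j)

end GradedFreeResolution

/-- The Castelnuovo–Mumford regularity `sup {j - i : β_{i,j}(M) ≠ 0}` of a finitely generated
graded module over the polynomial ring, `-∞` (i.e. `⊥`) if all `β_{i,j}(M)` vanish. The Betti
numbers do not depend on the graded free resolution used to compute them; no choice of one is
made here. -/
noncomputable def reg {M : Type*} [AddCommGroup M] [Module (MvPolynomial (Fin n) K) M]
    (ℳ : ℤ → AddSubgroup M) : EReal :=
  ⨆ (F : GradedFreeResolution n K ℳ) (i : ℕ) (j : ℤ) (_ : F.betti i j ≠ 0), (((j - i : ℤ) : ℝ) : EReal)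

variable {n K}

/-- `u_k`, of degree `d_k`, form a minimal system of homogeneous generators of `I`: they generate
`I` and the kernel of `φ : F → S`, `φ(e_k) = u_k`, is contained in `𝔪 F`. -/
structure IsMinimalGenerators {r : ℕ} (I : Ideal (MvPolynomial (Fin n) K))
    (u : Fin r → MvPolynomial (Fin n) K) (d : Fin r → ℕ) : Prop where
  homogeneous : ∀ k, (u k).IsHomogeneous (d k)
  span_eq : Ideal.span (Set.range u) = I
  minimal : ∀ a : Fin r → MvPolynomial (Fin n) K,
    ∑ k, a k * u k = 0 → ∀ k, a k ∈ Ideal.span (Set.range (X : Fin n → MvPolynomial (Fin n) K))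

/-- The ideal `I` is generated by homogeneous elements of degree at most `c`. -/
def GeneratedInDegreesLE (I : Ideal (MvPolynomial (Fin n) K)) (c : ℕ) : Prop :=
  Ideal.span {f | f ∈ I ∧ ∃ i ≤ c, f.IsHomogeneous i} = I

/-- `dim_K [S/I]_c`. -/
noncomputable def quotientDim (I : Ideal (MvPolynomial (Fin n) K)) (c : ℕ) : ℕ :=
  Module.finrank K ((homogeneousSubmodule (Fin n) K c).map (Ideal.Quotient.mkₐ K I).toLinearMap)

end Graded

end KoszulReg

/-! The bound comes from induction on the number of degree-`c` forms missing from `I`. Lifting a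
basis of `[S/I]_c` gives `v` forms of degree `c` which, together with `I`, generate all forms of
degree `c` (`exists_complement_forms`). Adjoining them one by one to the generators reaches the case
where every form of degree `c` lies in `(u)`. They are then removed again, and each removal costs
one unit of regularity. Write `a = reg M`, and let `K_t`, `B_t` be the Koszul chains and boundaries.

Base case (`regLE_cyclePieces_of_forms_mem`): since `(u)` annihilates Koszul homology, a bound `b`
for `reg Z_t` makes `H_t` vanish in degrees at least `b + c`. The sequences `0 → B_t → Z_t → H_t →
0` and `0 → Z_{t+1} → K_{t+1} → B_t → 0` then give `reg Z_{t+1} ≤ b + c + 1`.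

Removal of `u_r` of degree `c` (`regLE_cyclePieces_castSucc`): let primes denote the complex without
`u_r`, and let `W_t ⊆ Z'_t` consist of the `z` with `u_r z ∈ B'_t`. The cone sequence `0 → Z'_{t+1}
→ Z_{t+1} → W_t(-c) → 0` and descending induction on `t` bound `reg W_t`. The quotient `Z'_t / W_t`
embeds in homology up to a shift, so it vanishes in large degrees and its regularity is its top
socle degree. That degree is read from `Tor_n`, which is bounded using `Tor_n(Z'_t) ⊆ Tor_n(K'_t)`
and `Tor_{n-1}(W_t)`. The same socle argument applied to `H_t = Z_t / B_t` gives the second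
inequality (`regLE_homologyPieces`).

The vanishing in large degrees (`exists_cyclePieces_le_boundaries`) is where `dim M/IM ≤ 0` enters.
All `Tor` arguments use the Koszul complex of the variables; `GradedFreeResolution.torVanishes_iff`
identifies the result with Betti numbers of an arbitrary graded free resolution. -/

namespace KoszulReg

/-! ### The Koszul complex: coefficients, exterior multiplication, annihilation of homology by
`(u)`. -/

section KoszulComplex

variable {S : Type*} [CommRing S] {r : ℕ} {A B : Type*} [AddCommGroup A] [Module S A]
  [AddCommGroup B] [Module S B]

/-- The coefficient family of a chain, extended by zero to all subsets of the index set. -/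
def Chain.coeff {t : ℕ} (z : Chain r t A) (J : Finset (Fin r)) : A :=
  if h : J.card = t then z ⟨J, h⟩ else 0

theorem Chain.coeff_of_card {t : ℕ} (z : Chain r t A) {J : Finset (Fin r)} (h : J.card = t) :
    z.coeff J = z ⟨J, h⟩ := dif_pos h

theorem diff_apply (u : Fin r → S) (t : ℕ) (z : Chain r (t + 1) A)
    (J : {J : Finset (Fin r) // J.card = t}) :
    diff u A t z J =
      ∑ k, if k ∈ J.1 then 0 else (sgn S k J.1 * u k) • z.coeff (insert k J.1) := by
  have h1 : ∀ k : {k : Fin r // k ∉ J.1}, (sgn S k.1 J.1 * u k.1) • z (ins J k) =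
      (sgn S k.1 J.1 * u k.1) • z.coeff (insert k.1 J.1) := by
    intro k
    exact congrArg _ (Chain.coeff_of_card z (ins J k).2).symm
  have h2 : diff u A t z J =
      ∑ k : {k : Fin r // k ∉ J.1}, (sgn S k.1 J.1 * u k.1) • z (ins J k) := rfl
  rw [h2, Finset.sum_congr rfl fun k _ => h1 k]
  have h3 := Finset.sum_subtype (p := fun k => k ∉ J.1) (F := inferInstance)
    (Finset.univ.filter (fun k : Fin r => k ∉ J.1)) (by simp)
    (fun k => (sgn S k J.1 * u k) • z.coeff (insert k J.1))
  rw [← h3, Finset.sum_filter]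
  refine Finset.sum_congr rfl fun k _ => ?_
  split_ifs <;> simp_all

theorem diff_comp (u : Fin r → S) (t : ℕ) (g : A →ₗ[S] B) (z : Chain r (t + 1) A) :
    diff u B t (fun J => g (z J)) = fun J => g (diff u A t z J) := by
  funext J
  simp [diff, map_sum]

theorem comp_mem_cycles {u : Fin r → S} {t : ℕ} (g : A →ₗ[S] B) {z : Chain r t A}
    (hz : z ∈ cycles u A t) : (fun J => g (z J)) ∈ cycles u B t := by
  cases t with
  | zero => trivial
  | succ t =>
    have h : diff u A t z = 0 := hz
    change diff u B t _ = 0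
    rw [diff_comp, h]
    funext J
    simp

theorem diff_mem_cycles (u : Fin r → S) (t : ℕ) (z : Chain r (t + 1) A) :
    diff u A t z ∈ cycles u A t :=
  boundaries_le_cycles u A t ⟨z, rfl⟩

theorem mem_cycles_of_diff_eq_zero {u : Fin r → S} {t : ℕ} {z : Chain r (t + 1) A}
    (h : diff u A t z = 0) : z ∈ cycles u A (t + 1) := h

theorem diff_eq_zero_of_mem_cycles {u : Fin r → S} {t : ℕ} {z : Chain r (t + 1) A}
    (h : z ∈ cycles u A (t + 1)) : diff u A t z = 0 := h

theorem isEmpty_index_of_lt {t : ℕ} (h : r < t) : IsEmpty {J : Finset (Fin r) // J.card = t} :=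
  ⟨fun J => by
    have := Finset.card_le_univ J.1
    rw [J.2, Fintype.card_fin] at this
    omega⟩

theorem eq_zero_of_lt {t : ℕ} (h : r < t) (z : Chain r t A) : z = 0 := by
  funext J
  exact ((isEmpty_index_of_lt h).false J).elim

theorem chain_zero_ext_empty {A : Type*} {z z' : Chain r 0 A} (h : z ⟨∅, rfl⟩ = z' ⟨∅, rfl⟩) :
    z = z' := by
  funext J
  obtain ⟨J, hJ⟩ := J
  obtain rfl := Finset.card_eq_zero.1 hJ
  exact h

theorem diff_zero_apply (u : Fin r → S) (w : Chain r 1 A) :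
    diff u A 0 w ⟨∅, rfl⟩ = ∑ k, u k • w ⟨{k}, Finset.card_singleton k⟩ := by
  rw [diff_apply]
  refine Finset.sum_congr rfl fun k _ => ?_
  rw [if_neg (Finset.notMem_empty k), Chain.coeff_of_card w (by simp)]
  simp [sgn]

theorem exists_chain_one {A : Type*} (w : Fin r → A) :
    ∃ v : Chain r 1 A, ∀ k, v ⟨{k}, Finset.card_singleton k⟩ = w k := by
  refine ⟨fun J => w ((Finset.card_eq_one.1 J.2).choose), fun k => ?_⟩
  have := (Finset.card_eq_one.1 (Finset.card_singleton k)).choose_spec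
  exact congrArg w (Finset.singleton_injective this).symm

theorem mem_boundaries_zero_iff (u : Fin r → S) (y : Chain r 0 A) :
    y ∈ boundaries u A 0 ↔ ∃ w : Fin r → A, y ⟨∅, rfl⟩ = ∑ k, u k • w k := by
  constructor
  · rintro ⟨w, rfl⟩
    exact ⟨_, diff_zero_apply u w⟩
  · rintro ⟨w, hw⟩
    obtain ⟨v, hv⟩ := exists_chain_one w
    refine ⟨v, chain_zero_ext_empty ?_⟩
    rw [diff_zero_apply, hw]
    exact Finset.sum_congr rfl fun k _ => by rw [hv]

theorem sgn_mul_self (k : Fin r) (J : Finset (Fin r)) : sgn S k J * sgn S k J = 1 := by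
  unfold sgn
  rw [← mul_pow]
  simp

theorem sgn_insert_mul_sgn_insert {k l : Fin r} {J : Finset (Fin r)} (hk : k ∉ J) (hl : l ∉ J)
    (h : k ≠ l) :
    sgn S l (insert k J) * sgn S k (insert l J) = - (sgn S k J * sgn S l J) := by
  simp only [sgn, Finset.filter_insert]
  rcases lt_or_gt_of_ne h with h | h
  · rw [if_pos h, if_neg h.not_gt, Finset.card_insert_of_notMem (by simp [hk])]
    ring
  · rw [if_neg h.not_gt, if_pos h, Finset.card_insert_of_notMem (by simp [hl])]
    ring

/-- Left exterior multiplication by `e_k`. -/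
def wedge (S : Type*) [CommRing S] {A : Type*} [AddCommGroup A] [Module S A] (k : Fin r) {t : ℕ}
    (z : Chain r t A) : Chain r (t + 1) A :=
  fun J => if k ∈ J.1 then sgn S k (J.1.erase k) • z.coeff (J.1.erase k) else 0

theorem wedge_coeff_insert {k : Fin r} {t : ℕ} (z : Chain r t A) {J : Finset (Fin r)}
    (hk : k ∉ J) : (wedge S k z).coeff (insert k J) = sgn S k J • z.coeff J := by
  by_cases h : J.card = t
  · rw [Chain.coeff_of_card _ (by rw [Finset.card_insert_of_notMem hk, h])]
    simp [wedge, hk]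
  · rw [Chain.coeff, dif_neg, Chain.coeff, dif_neg h, smul_zero]
    rw [Finset.card_insert_of_notMem hk]
    omega

theorem wedge_coeff_of_notMem {k : Fin r} {t : ℕ} (z : Chain r t A) {J : Finset (Fin r)}
    (hk : k ∉ J) : (wedge S k z).coeff J = 0 := by
  unfold Chain.coeff wedge
  split_ifs <;> simp_all

/-- The homotopy formula `∂(e_k ∧ z) + e_k ∧ ∂z = u_k z` with `∂z = 0`. It is the reason why `(u)`
annihilates Koszul homology. -/
theorem diff_wedge_of_mem_cycles (u : Fin r → S) (k : Fin r) {t : ℕ} {z : Chain r t A}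
    (hz : z ∈ cycles u A t) : diff u A t (wedge S k z) = u k • z := by
  funext J
  rw [diff_apply]
  by_cases hk : k ∈ J.1
  · obtain ⟨t, rfl⟩ : ∃ s, t = s + 1 := by
      refine Nat.exists_eq_succ_of_ne_zero ?_
      rw [← J.2]
      exact Finset.card_ne_zero_of_mem hk
    have hz0 : diff u A t z = 0 := hz
    obtain ⟨J, hJ⟩ := J
    simp only at hk
    obtain ⟨J', hkJ', rfl⟩ : ∃ J', k ∉ J' ∧ insert k J' = J :=
      ⟨J.erase k, by simp, Finset.insert_erase hk⟩
    have hJ' : J'.card = t := by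
      rw [Finset.card_insert_of_notMem hkJ'] at hJ
      omega
    have hd := congrFun hz0 ⟨J', hJ'⟩
    rw [diff_apply] at hd
    simp only [Pi.zero_apply] at hd
    -- The summand `l = k`, absent on the left, is added and subtracted; by the sign rule the rest
    -- is then a multiple of the coefficient of `∂z` at `J'`, which vanishes.
    have key : ∀ l : Fin r, (if l ∈ insert k J' then (0 : A) else
        (sgn S l (insert k J') * u l) • (wedge S k z).coeff (insert l (insert k J'))) =
        (if l = k then u k • z.coeff (insert k J') else 0) - sgn S k J' •
          (if l ∈ J' then 0 else (sgn S l J' * u l) • z.coeff (insert l J')) := by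
      intro l
      by_cases hlk : l = k
      · subst hlk
        simp only [Finset.mem_insert_self, if_true, if_neg hkJ', smul_smul]
        rw [← mul_assoc, sgn_mul_self, one_mul, sub_self]
      · by_cases hl : l ∈ J'
        · simp [hl, hlk]
        · have h1 : l ∉ insert k J' := by simp [hl, hlk]
          have h2 : k ∉ insert l J' := by simp [hkJ', Ne.symm hlk]
          rw [if_neg h1, if_neg hl, if_neg hlk, zero_sub, Finset.insert_comm,
            wedge_coeff_insert z h2, smul_smul, smul_smul, ← neg_smul]
          congr 1
          have := sgn_insert_mul_sgn_insert (S := S) hkJ' hl (Ne.symm hlk)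
          linear_combination u l * this
    rw [Finset.sum_congr rfl fun l _ => key l, Finset.sum_sub_distrib, ← Finset.smul_sum, hd]
    simp [Chain.coeff_of_card z hJ]
  · rw [Finset.sum_eq_single k]
    · rw [if_neg hk, wedge_coeff_insert z hk, Chain.coeff_of_card z J.2, smul_smul,
        mul_right_comm, sgn_mul_self, one_mul]
      rfl
    · intro l _ hl
      split_ifs with h
      · rfl
      · rw [wedge_coeff_of_notMem, smul_zero]
        simp [hk, Ne.symm hl]
    · simp

theorem smul_mem_boundaries {u : Fin r → S} {a : S} (ha : a ∈ Ideal.span (Set.range u)) {t : ℕ}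
    {z : Chain r t A} (hz : z ∈ cycles u A t) : a • z ∈ boundaries u A t := by
  induction ha using Submodule.span_induction with
  | mem x hx =>
    obtain ⟨k, rfl⟩ := hx
    exact ⟨_, diff_wedge_of_mem_cycles u k hz⟩
  | zero => rw [zero_smul]; exact Submodule.zero_mem _
  | add x y _ _ hx hy => rw [add_smul]; exact Submodule.add_mem _ hx hy
  | smul b x _ hx => rw [smul_eq_mul, mul_smul]; exact Submodule.smul_mem _ _ hx

end KoszulComplex

/-! ### The Koszul complex with one more generator as a mapping cone. -/

section Cone

variable {S : Type*} [CommRing S] {r : ℕ} {A : Type*}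

/-- A subset of `Fin r`, regarded as a subset of `Fin (r + 1)`. -/
def low {t : ℕ} (J : {J : Finset (Fin r) // J.card = t}) :
    {J : Finset (Fin (r + 1)) // J.card = t} :=
  ⟨J.1.map Fin.castSuccEmb, by rw [Finset.card_map, J.2]⟩

theorem last_notMem_map (J : Finset (Fin r)) : Fin.last r ∉ J.map Fin.castSuccEmb := by
  simp only [Finset.mem_map, not_exists, not_and]
  intro k _ h
  exact (Fin.castSucc_lt_last k).ne h

/-- A subset of `Fin r`, enlarged by the last element of `Fin (r + 1)`. -/
def high {t : ℕ} (J : {J : Finset (Fin r) // J.card = t}) :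
    {J : Finset (Fin (r + 1)) // J.card = t + 1} :=
  ⟨insert (Fin.last r) (J.1.map Fin.castSuccEmb), by
    rw [Finset.card_insert_of_notMem (last_notMem_map _), Finset.card_map, J.2]⟩

theorem exists_map_castSucc (J : Finset (Fin (r + 1))) (h : Fin.last r ∉ J) :
    ∃ J' : Finset (Fin r), J'.map Fin.castSuccEmb = J := by
  refine ⟨Finset.univ.filter fun k => k.castSucc ∈ J, ?_⟩
  ext k
  simp only [Finset.mem_map, Finset.mem_filter, Finset.mem_univ, true_and, Fin.coe_castSuccEmb]
  constructor
  · rintro ⟨l, hl, rfl⟩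
    exact hl
  · intro hk
    induction k using Fin.lastCases with
    | last => exact absurd hk h
    | cast k => exact ⟨k, hk, rfl⟩

theorem exists_low {t : ℕ} (J : {J : Finset (Fin (r + 1)) // J.card = t})
    (h : Fin.last r ∉ J.1) : ∃ J', low J' = J := by
  obtain ⟨J', hJ'⟩ := exists_map_castSucc J.1 h
  exact ⟨⟨J', by rw [← J.2, ← hJ', Finset.card_map]⟩, Subtype.ext hJ'⟩

theorem exists_high {t : ℕ} (J : {J : Finset (Fin (r + 1)) // J.card = t + 1})
    (h : Fin.last r ∈ J.1) : ∃ J', high J' = J := by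
  obtain ⟨J', hJ'⟩ := exists_map_castSucc (J.1.erase (Fin.last r)) (by simp)
  have hins : insert (Fin.last r) (J'.map Fin.castSuccEmb) = J.1 := by
    rw [hJ', Finset.insert_erase h]
  refine ⟨⟨J', ?_⟩, Subtype.ext hins⟩
  have := J.2
  rw [← hins, Finset.card_insert_of_notMem (last_notMem_map _), Finset.card_map] at this
  omega

theorem low_injective {t : ℕ} : Function.Injective (low (r := r) (t := t)) := by
  intro J J' h
  exact Subtype.ext (Finset.map_injective _ (congrArg Subtype.val h))

theorem high_injective {t : ℕ} : Function.Injective (high (r := r) (t := t)) := by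
  intro J J' h
  have h1 := congrArg (fun s : {J : Finset (Fin (r + 1)) // J.card = t + 1} =>
    s.1.erase (Fin.last r)) h
  simp only [high, Finset.erase_insert (last_notMem_map _)] at h1
  exact Subtype.ext (Finset.map_injective _ h1)

theorem last_notMem_low {t : ℕ} (J : {J : Finset (Fin r) // J.card = t}) :
    Fin.last r ∉ (low J).1 := last_notMem_map _

theorem last_mem_high {t : ℕ} (J : {J : Finset (Fin r) // J.card = t}) :
    Fin.last r ∈ (high J).1 := Finset.mem_insert_self _ _

open Classical in
/-- The chain `y + w ∧ e_r` of the Koszul complex of `u_0, …, u_r`. -/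
noncomputable def glue {t : ℕ} (y : Chain r (t + 1) A) (w : Chain r t A) :
    Chain (r + 1) (t + 1) A :=
  fun J => if h : Fin.last r ∈ J.1 then w (exists_high J h).choose else y (exists_low J h).choose

theorem glue_low {t : ℕ} (y : Chain r (t + 1) A) (w : Chain r t A)
    (J : {J : Finset (Fin r) // J.card = t + 1}) : glue y w (low J) = y J := by
  have h := last_notMem_low J
  rw [glue, dif_neg h]
  congr 1
  exact low_injective (exists_low (low J) h).choose_spec

theorem glue_high {t : ℕ} (y : Chain r (t + 1) A) (w : Chain r t A)
    (J : {J : Finset (Fin r) // J.card = t}) : glue y w (high J) = w J := by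
  have h := last_mem_high J
  rw [glue, dif_pos h]
  congr 1
  exact high_injective (exists_high (high J) h).choose_spec

theorem chain_ext {t : ℕ} {z z' : Chain (r + 1) (t + 1) A} (h1 : ∀ J, z (low J) = z' (low J))
    (h2 : ∀ J, z (high J) = z' (high J)) : z = z' := by
  funext J
  by_cases h : Fin.last r ∈ J.1
  · obtain ⟨J, rfl⟩ := exists_high J h
    exact h2 J
  · obtain ⟨J, rfl⟩ := exists_low J h
    exact h1 J

theorem chain_zero_ext {z z' : Chain (r + 1) 0 A} (h1 : ∀ J, z (low J) = z' (low J)) :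
    z = z' := by
  funext J
  obtain ⟨J, rfl⟩ := exists_low J (by rw [Finset.card_eq_zero.1 J.2]; simp)
  exact h1 J

variable [AddCommGroup A] [Module S A]

/-- The part of a chain not involving the last basis element. -/
def lowPart (S : Type*) [CommRing S] (A : Type*) [AddCommGroup A] [Module S A] (r t : ℕ) :
    Chain (r + 1) t A →ₗ[S] Chain r t A where
  toFun z := fun J => z (low J)
  map_add' _ _ := rfl
  map_smul' _ _ := rfl

/-- The part of a chain involving the last basis element. -/
def highPart (S : Type*) [CommRing S] (A : Type*) [AddCommGroup A] [Module S A] (r t : ℕ) :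
    Chain (r + 1) (t + 1) A →ₗ[S] Chain r t A where
  toFun z := fun J => z (high J)
  map_add' _ _ := rfl
  map_smul' _ _ := rfl

theorem sgn_low (k : Fin r) (J : Finset (Fin r)) :
    sgn S k.castSucc (J.map Fin.castSuccEmb) = sgn S k J := by
  unfold sgn
  rw [Finset.filter_map, Finset.card_map]
  congr 2

theorem sgn_high (k : Fin r) (J : Finset (Fin r)) :
    sgn S k.castSucc (insert (Fin.last r) (J.map Fin.castSuccEmb)) = sgn S k J := by
  rw [← sgn_low k J]
  unfold sgn
  rw [Finset.filter_insert, if_neg]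
  exact (Fin.castSucc_lt_last k).not_gt

theorem sgn_last (J : Finset (Fin r)) :
    sgn S (Fin.last r) (J.map Fin.castSuccEmb) = (-1) ^ J.card := by
  unfold sgn
  rw [Finset.filter_true_of_mem, Finset.card_map]
  intro j hj
  refine lt_of_le_of_ne (Fin.le_last j) ?_
  rintro rfl
  exact last_notMem_map J hj

theorem coeff_low {t : ℕ} (z : Chain (r + 1) t A) (J : Finset (Fin r)) :
    z.coeff (J.map Fin.castSuccEmb) = (lowPart S A r t z).coeff J := by
  unfold Chain.coeff
  simp only [Finset.card_map]
  rfl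

theorem coeff_high {t : ℕ} (z : Chain (r + 1) (t + 1) A) (J : Finset (Fin r)) :
    z.coeff (insert (Fin.last r) (J.map Fin.castSuccEmb)) = (highPart S A r t z).coeff J := by
  unfold Chain.coeff
  have : (insert (Fin.last r) (J.map Fin.castSuccEmb)).card = t + 1 ↔ J.card = t := by
    rw [Finset.card_insert_of_notMem (last_notMem_map _), Finset.card_map]
    omega
  by_cases h : J.card = t
  · rw [dif_pos (this.2 h), dif_pos h]
    rfl
  · rw [dif_neg (fun h' => h (this.1 h')), dif_neg h]

/-- The connecting term of the cone. The last basis element exceeds all `t` elements of `J`, whence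
the sign `(-1)^t`. -/
theorem lowPart_diff (u : Fin (r + 1) → S) (t : ℕ) (z : Chain (r + 1) (t + 1) A) :
    lowPart S A r t (diff u A t z) = diff (fun k => u k.castSucc) A t (lowPart S A r (t + 1) z) +
      ((-1) ^ t * u (Fin.last r)) • highPart S A r t z := by
  funext J
  have h0 : lowPart S A r t (diff u A t z) J = diff u A t z (low J) := rfl
  rw [h0, Pi.add_apply, diff_apply, diff_apply, Fin.sum_univ_castSucc]
  congr 1
  · refine Finset.sum_congr rfl fun k _ => ?_
    have h1 : k.castSucc ∈ (low J).1 ↔ k ∈ J.1 := by simp [low]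
    have h2 : insert k.castSucc (low J).1 = (insert k J.1).map Fin.castSuccEmb := by
      simp [low, Finset.map_insert]
    simp only [h1, h2, coeff_low (S := S)]
    rw [show (low J).1 = J.1.map Fin.castSuccEmb from rfl, sgn_low]
  · rw [if_neg (last_notMem_low J)]
    rw [show (low J).1 = J.1.map Fin.castSuccEmb from rfl, sgn_last, coeff_high (S := S), J.2,
      Chain.coeff_of_card _ J.2]
    rfl

theorem highPart_diff (u : Fin (r + 1) → S) (t : ℕ) (z : Chain (r + 1) (t + 2) A) :
    highPart S A r t (diff u A (t + 1) z) =
      diff (fun k => u k.castSucc) A t (highPart S A r (t + 1) z) := by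
  funext J
  have h0 : highPart S A r t (diff u A (t + 1) z) J = diff u A (t + 1) z (high J) := rfl
  rw [h0, diff_apply, diff_apply, Fin.sum_univ_castSucc, if_pos (last_mem_high J), add_zero]
  refine Finset.sum_congr rfl fun k _ => ?_
  have h1 : k.castSucc ∈ (high J).1 ↔ k ∈ J.1 := by
    simp [high, (Fin.castSucc_lt_last k).ne]
  have h2 : insert k.castSucc (high J).1 =
      insert (Fin.last r) ((insert k J.1).map Fin.castSuccEmb) := by
    simp [high, Finset.map_insert, Finset.insert_comm]
  simp only [h1, h2, coeff_high (S := S)]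
  rw [show (high J).1 = insert (Fin.last r) (J.1.map Fin.castSuccEmb) from rfl, sgn_high]

theorem lowPart_glue {t : ℕ} (y : Chain r (t + 1) A) (w : Chain r t A) :
    lowPart S A r (t + 1) (glue y w) = y := funext fun J => glue_low y w J

theorem highPart_glue {t : ℕ} (y : Chain r (t + 1) A) (w : Chain r t A) :
    highPart S A r t (glue y w) = w := funext fun J => glue_high y w J

/-- If the Koszul complex of `u_0, …, u_{r-1}` is acyclic in positive degrees and `u_r` is a
nonzerodivisor modulo `(u_0, …, u_{r-1})`, the Koszul complex of `u_0, …, u_r` is acyclic in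
positive degrees. -/
theorem acyclic_succ (u : Fin (r + 1) → S)
    (h : ∀ t, cycles (fun k => u k.castSucc) A (t + 1) ≤
      boundaries (fun k => u k.castSucc) A (t + 1))
    (hreg : ∀ w : Chain r 0 A, u (Fin.last r) • w ∈ boundaries (fun k => u k.castSucc) A 0 →
      w ∈ boundaries (fun k => u k.castSucc) A 0) (t : ℕ) :
    cycles u A (t + 1) ≤ boundaries u A (t + 1) := by
  intro z hz
  have hz0 : diff u A t z = 0 := hz
  have hlow := lowPart_diff u t z
  rw [hz0, map_zero] at hlow
  -- In homological degree zero every chain is a cycle, so acyclicity says nothing and the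
  -- nonzerodivisor hypothesis takes its place.
  have hw : highPart S A r t z ∈ boundaries (fun k => u k.castSucc) A t := by
    cases t with
    | zero =>
      refine hreg _ ⟨- lowPart S A r 1 z, ?_⟩
      rw [map_neg, eq_comm, ← sub_eq_zero]
      simpa [add_comm] using hlow.symm
    | succ t =>
      refine h t (mem_cycles_of_diff_eq_zero ?_)
      rw [← highPart_diff, hz0, map_zero]
  obtain ⟨w, hw⟩ := hw
  -- The subtracted term is the low part of `∂ (glue 0 w)`, so the difference is a cycle of the
  -- shorter complex.
  have hy : lowPart S A r (t + 1) z - ((-1) ^ (t + 1) * u (Fin.last r)) • w ∈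
      cycles (fun k => u k.castSucc) A (t + 1) := by
    refine mem_cycles_of_diff_eq_zero ?_
    rw [map_sub, map_smul, hw, pow_succ, hlow]
    module
  obtain ⟨y, hy⟩ := h t hy
  refine ⟨glue y w, chain_ext (fun J => ?_) (fun J => ?_)⟩
  · have := congrFun (lowPart_diff u (t + 1) (glue y w)) J
    rw [lowPart_glue, highPart_glue, hy, sub_add_cancel] at this
    exact this
  · have := congrFun (highPart_diff u t (glue y w)) J
    rw [highPart_glue, hw] at this
    exact this

end Cone

open MvPolynomial

/-! ### Internal degrees of Koszul chains. -/

section Pieces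

variable {S : Type*} [CommRing S] {r : ℕ} {N : Type*} [AddCommGroup N] [Module S N]

/-- The grading of a product of copies of a graded module, shifted by the integers `s`. -/
def piGrading {N : Type*} [AddCommGroup N] {ι : Type*} (𝒩 : ℤ → AddSubgroup N) (s : ι → ℤ)
    (j : ℤ) : AddSubgroup (ι → N) where
  carrier := {z | ∀ i, z i ∈ 𝒩 (j - s i)}
  zero_mem' := fun _ => (𝒩 _).zero_mem
  add_mem' := fun hx hy i => (𝒩 _).add_mem (hx i) (hy i)
  neg_mem' := fun hx i => (𝒩 _).neg_mem (hx i)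

/-- The internal grading of the Koszul chains, when the basis element `e_k` has degree `d_k`. -/
abbrev chainGrading {N : Type*} [AddCommGroup N] (d : Fin r → ℕ) (𝒩 : ℤ → AddSubgroup N) (t : ℕ)
    (j : ℤ) : AddSubgroup (Chain r t N) :=
  piGrading 𝒩 (fun J : {J : Finset (Fin r) // J.card = t} => ∑ k ∈ J.1, (d k : ℤ)) j

theorem sgn_mul_smul_mem (H : AddSubgroup N) (k : Fin r) (J : Finset (Fin r)) {a : S} {m : N}
    (h : a • m ∈ H) : (sgn S k J * a) • m ∈ H := by
  unfold sgn
  rcases neg_one_pow_eq_or S (J.filter (fun j => j < k)).card with h' | h' <;> rw [h']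
  · rwa [one_mul]
  · rw [neg_one_mul, neg_smul]
    exact H.neg_mem h

theorem diff_mem_chainGrading {u : Fin r → S} {d : Fin r → ℕ} {𝒩 : ℤ → AddSubgroup N}
    (hu : ∀ k j m, m ∈ 𝒩 j → u k • m ∈ 𝒩 (j + d k)) {t : ℕ} {j : ℤ} {z : Chain r (t + 1) N}
    (hz : z ∈ chainGrading d 𝒩 (t + 1) j) : diff u N t z ∈ chainGrading d 𝒩 t j := by
  intro J
  change ∑ k : {k : Fin r // k ∉ J.1}, (sgn S k.1 J.1 * u k.1) • z (ins J k) ∈ _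
  refine AddSubgroup.sum_mem (𝒩 _) fun k _ => sgn_mul_smul_mem _ k.1 J.1 ?_
  have h1 := hu k.1 _ _ (hz (ins J k))
  have h2 : ∑ l ∈ (ins J k).1, (d l : ℤ) = d k.1 + ∑ l ∈ J.1, (d l : ℤ) :=
    Finset.sum_insert k.2
  have h3 : j - ∑ l ∈ (ins J k).1, (d l : ℤ) + d k.1 = j - ∑ l ∈ J.1, (d l : ℤ) := by
    rw [h2]
    ring
  rwa [← h3]

end Pieces

/-! ### Degreewise `Tor` via the Koszul complex of the variables, and its long exact sequence. -/

section TorVanishing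

variable {n : ℕ} {K : Type*} [Field K]
  {A : Type*} [AddCommGroup A] [Module (MvPolynomial (Fin n) K) A]
  {B : Type*} [AddCommGroup B] [Module (MvPolynomial (Fin n) K) B]
  {C : Type*} [AddCommGroup C] [Module (MvPolynomial (Fin n) K) C]
  {𝒜 : ℤ → AddSubgroup A} {ℬ : ℤ → AddSubgroup B} {𝒞 : ℤ → AddSubgroup C}

variable (n K) in
/-- Multiplication by the variables maps the piece of degree `j` into the piece of degree
`j + 1`. -/
def XStable (𝒜 : ℤ → AddSubgroup A) : Prop :=
  ∀ (k : Fin n) (j : ℤ) (m : A), m ∈ 𝒜 j → (X k : MvPolynomial (Fin n) K) • m ∈ 𝒜 (j + 1)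

/-- Homogeneous chains of degree `j` in the Koszul complex of the variables. -/
abbrev xGrading (n : ℕ) (𝒜 : ℤ → AddSubgroup A) (i : ℕ) (j : ℤ) : AddSubgroup (Chain n i A) :=
  chainGrading (fun _ => 1) 𝒜 i j

variable (n K A) in
/-- The differential of the Koszul complex of the variables. -/
noncomputable abbrev xDiff (i : ℕ) : Chain n (i + 1) A →ₗ[MvPolynomial (Fin n) K] Chain n i A :=
  diff (fun k => (X k : MvPolynomial (Fin n) K)) A i

variable (n K A) in
/-- The cycles of the Koszul complex of the variables. -/
noncomputable abbrev xCycles (i : ℕ) : Submodule (MvPolynomial (Fin n) K) (Chain n i A) :=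
  cycles (fun k => (X k : MvPolynomial (Fin n) K)) A i

theorem mem_xGrading {i : ℕ} {j : ℤ} {z : Chain n i A} :
    z ∈ xGrading n 𝒜 i j ↔ ∀ J, z J ∈ 𝒜 (j - i) := by
  have h : ∀ J : {J : Finset (Fin n) // J.card = i}, ∑ k ∈ J.1, ((1 : ℕ) : ℤ) = i := by
    intro J
    simp [J.2]
  change (∀ J : {J : Finset (Fin n) // J.card = i}, z J ∈ 𝒜 (j - ∑ k ∈ J.1, ((1 : ℕ) : ℤ))) ↔ _
  simp only [h]

theorem XStable.xDiff_mem (h : XStable n K 𝒜) {i : ℕ} {j : ℤ} {z : Chain n (i + 1) A}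
    (hz : z ∈ xGrading n 𝒜 (i + 1) j) : xDiff n K A i z ∈ xGrading n 𝒜 i j :=
  diff_mem_chainGrading (fun k j m hm => h k j m hm) hz

variable (n K) in
/-- Vanishing of the degree `j` part of the `i`-th Koszul homology of the variables, that is,
of `Tor_i(-, K)_j`. -/
def TorVanishes (𝒜 : ℤ → AddSubgroup A) (i : ℕ) (j : ℤ) : Prop :=
  ∀ z ∈ xGrading n 𝒜 i j, z ∈ xCycles n K A i →
    ∃ w ∈ xGrading n 𝒜 (i + 1) j, xDiff n K A i w = z

variable (n K) in
/-- A degreewise short exact sequence of families of pieces. -/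
structure PieceExact (𝒜 : ℤ → AddSubgroup A) (ℬ : ℤ → AddSubgroup B) (𝒞 : ℤ → AddSubgroup C)
    (f : A →ₗ[MvPolynomial (Fin n) K] B) (g : B →ₗ[MvPolynomial (Fin n) K] C) : Prop where
  f_mem : ∀ {j a}, a ∈ 𝒜 j → f a ∈ ℬ j
  f_inj : ∀ {j a}, a ∈ 𝒜 j → f a = 0 → a = 0
  g_mem : ∀ {j b}, b ∈ ℬ j → g b ∈ 𝒞 j
  g_f : ∀ {j a}, a ∈ 𝒜 j → g (f a) = 0
  exact : ∀ {j b}, b ∈ ℬ j → g b = 0 → ∃ a ∈ 𝒜 j, f a = b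
  surj : ∀ {j c}, c ∈ 𝒞 j → ∃ b ∈ ℬ j, g b = c

namespace PieceExact

variable {f : A →ₗ[MvPolynomial (Fin n) K] B} {g : B →ₗ[MvPolynomial (Fin n) K] C}
  (E : PieceExact n K 𝒜 ℬ 𝒞 f g)
include E

theorem lift_right {i : ℕ} {j : ℤ} {z : Chain n i C} (hz : z ∈ xGrading n 𝒞 i j) :
    ∃ w ∈ xGrading n ℬ i j, (fun J => g (w J)) = z := by
  choose w hw hgw using fun J => E.surj (hz J)
  exact ⟨w, hw, funext hgw⟩

theorem lift_left {i : ℕ} {j : ℤ} {z : Chain n i B} (hz : z ∈ xGrading n ℬ i j)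
    (h : (fun J => g (z J)) = 0) : ∃ w ∈ xGrading n 𝒜 i j, (fun J => f (w J)) = z := by
  choose w hw hfw using fun J => E.exact (hz J) (congrFun h J)
  exact ⟨w, hw, funext hfw⟩

theorem chain_inj {i : ℕ} {j : ℤ} {z : Chain n i A} (hz : z ∈ xGrading n 𝒜 i j)
    (h : (fun J => f (z J)) = 0) : z = 0 :=
  funext fun J => E.f_inj (hz J) (congrFun h J)

theorem map_left_mem {i : ℕ} {j : ℤ} {z : Chain n i A} (hz : z ∈ xGrading n 𝒜 i j) :
    (fun J => f (z J)) ∈ xGrading n ℬ i j := fun J => E.f_mem (hz J)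

theorem map_right_mem {i : ℕ} {j : ℤ} {z : Chain n i B} (hz : z ∈ xGrading n ℬ i j) :
    (fun J => g (z J)) ∈ xGrading n 𝒞 i j := fun J => E.g_mem (hz J)

/-- If `f` is injective on `i`-th homology and the `(i+1)`-st homology of the middle term
vanishes, so does that of the right term. -/
theorem torVanishes_right_of_inj (h𝒜 : XStable n K 𝒜) (hℬ : XStable n K ℬ) {i : ℕ} {j : ℤ}
    (hB : TorVanishes n K ℬ (i + 1) j)
    (hA : ∀ a ∈ xGrading n 𝒜 i j, a ∈ xCycles n K A i →
      (∃ b ∈ xGrading n ℬ (i + 1) j, xDiff n K B i b = fun J => f (a J)) →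
      ∃ a' ∈ xGrading n 𝒜 (i + 1) j, xDiff n K A i a' = a) :
    TorVanishes n K 𝒞 (i + 1) j := by
  intro z hz hzc
  obtain ⟨b, hb, rfl⟩ := E.lift_right hz
  have h0 := diff_eq_zero_of_mem_cycles hzc
  rw [diff_comp] at h0
  obtain ⟨a, ha, hab⟩ := E.lift_left (hℬ.xDiff_mem hb) h0
  have hac : a ∈ xCycles n K A i := by
    cases i with
    | zero => trivial
    | succ i =>
      refine mem_cycles_of_diff_eq_zero (E.chain_inj (h𝒜.xDiff_mem ha) ?_)
      rw [← diff_comp, hab, diff_diff]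
  obtain ⟨a', ha', haa⟩ := hA a ha hac ⟨b, hb, hab.symm⟩
  obtain ⟨b', hb', hbb⟩ := hB (b - fun J => f (a' J))
    ((xGrading n ℬ (i + 1) j).sub_mem hb (E.map_left_mem ha')) (by
      refine mem_cycles_of_diff_eq_zero ?_
      rw [map_sub, diff_comp, haa, hab, sub_self])
  refine ⟨fun J => g (b' J), E.map_right_mem hb', ?_⟩
  rw [diff_comp, hbb]
  funext J
  rw [Pi.sub_apply, map_sub, E.g_f (ha' J), sub_zero]

/-- If the `(i+1)`-st homology of the right term vanishes, `f` is injective on `i`-th homology. -/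
theorem inj_of_torVanishes_right (h𝒜 : XStable n K 𝒜) (hℬ : XStable n K ℬ) {i : ℕ} {j : ℤ}
    (hC : TorVanishes n K 𝒞 (i + 1) j) {a : Chain n i A} (ha : a ∈ xGrading n 𝒜 i j)
    {b : Chain n (i + 1) B} (hb : b ∈ xGrading n ℬ (i + 1) j)
    (hab : xDiff n K B i b = fun J => f (a J)) :
    ∃ a' ∈ xGrading n 𝒜 (i + 1) j, xDiff n K A i a' = a := by
  obtain ⟨c, hc, hcb⟩ := hC _ (E.map_right_mem hb) (by
    refine mem_cycles_of_diff_eq_zero ?_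
    rw [diff_comp, hab]
    funext J
    exact E.g_f (ha J))
  obtain ⟨b', hb', rfl⟩ := E.lift_right hc
  rw [diff_comp] at hcb
  obtain ⟨a', ha', haa⟩ := E.lift_left (z := b - xDiff n K B (i + 1) b')
    ((xGrading n ℬ (i + 1) j).sub_mem hb (hℬ.xDiff_mem hb')) (by
      funext J
      have := congrFun hcb J
      simp only [Pi.sub_apply, map_sub, this, sub_self, Pi.zero_apply])
  refine ⟨a', ha', sub_eq_zero.1 (E.chain_inj ((xGrading n 𝒜 i j).sub_mem (h𝒜.xDiff_mem ha') ha) ?_)⟩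
  funext J
  have h1 := diff_comp (fun k => (X k : MvPolynomial (Fin n) K)) i f a'
  rw [haa, map_sub, diff_diff, sub_zero, hab] at h1
  simp only [Pi.sub_apply, map_sub]
  exact sub_eq_zero.2 (congrFun h1 J).symm

/-- Exactness of `Tor_{i+1}(C) → Tor_i(A) → Tor_i(B)` in degree `j`. -/
theorem torVanishes_left (h𝒜 : XStable n K 𝒜) (hℬ : XStable n K ℬ) {i : ℕ} {j : ℤ}
    (hB : TorVanishes n K ℬ i j) (hC : TorVanishes n K 𝒞 (i + 1) j) : TorVanishes n K 𝒜 i j := by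
  intro z hz hzc
  obtain ⟨b, hb, hbz⟩ := hB _ (E.map_left_mem hz) (comp_mem_cycles f hzc)
  exact E.inj_of_torVanishes_right h𝒜 hℬ hC hz hb hbz

theorem torVanishes_right (h𝒜 : XStable n K 𝒜) (hℬ : XStable n K ℬ) {i : ℕ} {j : ℤ}
    (hB : TorVanishes n K ℬ (i + 1) j) (hA : TorVanishes n K 𝒜 i j) :
    TorVanishes n K 𝒞 (i + 1) j :=
  E.torVanishes_right_of_inj h𝒜 hℬ hB fun a ha hac _ => hA a ha hac

theorem torVanishes_zero_right {j : ℤ} (hB : TorVanishes n K ℬ 0 j) : TorVanishes n K 𝒞 0 j := by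
  intro z hz _
  obtain ⟨b, hb, rfl⟩ := E.lift_right hz
  obtain ⟨b', hb', rfl⟩ := hB b hb trivial
  exact ⟨fun J => g (b' J), E.map_right_mem hb', diff_comp _ _ _ _⟩

theorem torVanishes_middle (h𝒜 : XStable n K 𝒜) (hℬ : XStable n K ℬ) {i : ℕ} {j : ℤ}
    (hA : TorVanishes n K 𝒜 i j) (hC : TorVanishes n K 𝒞 i j) : TorVanishes n K ℬ i j := by
  intro z hz hzc
  obtain ⟨c, hc, hcz⟩ := hC _ (E.map_right_mem hz) (comp_mem_cycles g hzc)
  obtain ⟨b, hb, rfl⟩ := E.lift_right hc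
  rw [diff_comp] at hcz
  obtain ⟨a, ha, haz⟩ := E.lift_left (z := z - xDiff n K B i b)
    ((xGrading n ℬ i j).sub_mem hz (hℬ.xDiff_mem hb)) (by
      funext J
      have := congrFun hcz J
      simp only [Pi.sub_apply, map_sub, this, sub_self, Pi.zero_apply])
  have hac : a ∈ xCycles n K A i := by
    cases i with
    | zero => trivial
    | succ i =>
      refine mem_cycles_of_diff_eq_zero (E.chain_inj (h𝒜.xDiff_mem ha) ?_)
      rw [← diff_comp, haz, map_sub, diff_diff, diff_eq_zero_of_mem_cycles hzc, sub_zero]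
  obtain ⟨a', ha', rfl⟩ := hA a ha hac
  refine ⟨b + fun J => f (a' J), (xGrading n ℬ (i + 1) j).add_mem hb (E.map_left_mem ha'), ?_⟩
  rw [map_add, diff_comp, haz]
  abel

end PieceExact

/-- Vanishing of `Tor` is reflected by maps that are bijective on homogeneous pieces. -/
theorem TorVanishes.of_bijective {g : A →ₗ[MvPolynomial (Fin n) K] B} (h𝒜 : XStable n K 𝒜)
    (hmem : ∀ {j a}, a ∈ 𝒜 j → g a ∈ ℬ j) (hinj : ∀ {j a}, a ∈ 𝒜 j → g a = 0 → a = 0)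
    (hsurj : ∀ {j b}, b ∈ ℬ j → ∃ a ∈ 𝒜 j, g a = b) {i : ℕ} {j : ℤ}
    (h : TorVanishes n K ℬ i j) : TorVanishes n K 𝒜 i j := by
  intro z hz hzc
  obtain ⟨w, hw, hwz⟩ := h _ (fun J => hmem (hz J)) (comp_mem_cycles g hzc)
  choose v hv hgv using fun J => hsurj (hw J)
  refine ⟨v, hv, sub_eq_zero.1 (funext fun J => hinj
    ((xGrading n 𝒜 i j).sub_mem (h𝒜.xDiff_mem hv) hz J) ?_)⟩
  have h1 := diff_comp (fun k => (X k : MvPolynomial (Fin n) K)) i g v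
  rw [funext hgv, hwz] at h1
  rw [Pi.sub_apply, map_sub]
  exact sub_eq_zero.2 (congrFun h1 J).symm

theorem torVanishes_of_lt {i : ℕ} (hi : n < i) (j : ℤ) : TorVanishes n K 𝒜 i j := by
  intro z _ _
  exact ⟨0, AddSubgroup.zero_mem _, by rw [map_zero, eq_zero_of_lt hi z]⟩

theorem torVanishes_of_piece_eq_bot {i : ℕ} {j : ℤ} (h : 𝒜 (j - i) = ⊥) :
    TorVanishes n K 𝒜 i j := by
  intro z hz _
  refine ⟨0, AddSubgroup.zero_mem _, ?_⟩
  rw [map_zero]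
  funext J
  have := mem_xGrading.1 hz J
  rw [h, AddSubgroup.mem_bot] at this
  exact this.symm

theorem torVanishes_piGrading {ι : Type*} {s : ι → ℤ} {i : ℕ} {j : ℤ}
    (h : ∀ k, TorVanishes n K 𝒜 i (j - s k)) : TorVanishes n K (piGrading 𝒜 s) i j := by
  intro z hz hzc
  have h1 : ∀ k, ∃ w ∈ xGrading n 𝒜 (i + 1) (j - s k), xDiff n K A i w = fun J => z J k := by
    intro k
    refine h k _ ?_ (comp_mem_cycles (LinearMap.proj k) hzc)
    rw [mem_xGrading] at hz ⊢
    intro J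
    have := hz J k
    rwa [sub_right_comm] at this
  choose w hw hdw using h1
  refine ⟨fun J k => w k J, ?_, ?_⟩
  · rw [mem_xGrading]
    intro J k
    rw [sub_right_comm]
    exact mem_xGrading.1 (hw k) J
  · funext J k
    have h1 := diff_comp (fun k => (X k : MvPolynomial (Fin n) K)) i
      (LinearMap.proj (R := MvPolynomial (Fin n) K) (φ := fun _ : ι => A) k) (fun J k => w k J)
    have h2 := congrFun h1 J
    simp only [LinearMap.proj_apply] at h2
    rw [← h2, ← congrFun (hdw k) J]

variable (n K) in
/-- The elements of degree `j` of `𝔪 𝒜`. -/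
def xImage (𝒜 : ℤ → AddSubgroup A) (j : ℤ) : AddSubgroup A where
  carrier := {y | ∃ w : Fin n → A, (∀ k, w k ∈ 𝒜 (j - 1)) ∧
    y = ∑ k, (X k : MvPolynomial (Fin n) K) • w k}
  zero_mem' := ⟨0, fun _ => (𝒜 _).zero_mem, by simp⟩
  add_mem' := by
    rintro _ _ ⟨v, hv, rfl⟩ ⟨w, hw, rfl⟩
    exact ⟨v + w, fun k => (𝒜 _).add_mem (hv k) (hw k), by simp [Finset.sum_add_distrib]⟩
  neg_mem' := by
    rintro _ ⟨w, hw, rfl⟩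
    exact ⟨-w, fun k => (𝒜 _).neg_mem (hw k), by simp⟩

theorem exists_xDiff_zero_iff {j : ℤ} {y : Chain n 0 A} :
    (∃ w ∈ xGrading n 𝒜 1 j, xDiff n K A 0 w = y) ↔ y ⟨∅, rfl⟩ ∈ xImage n K 𝒜 j := by
  constructor
  · rintro ⟨w, hw, rfl⟩
    rw [mem_xGrading] at hw
    exact ⟨fun k => w ⟨{k}, Finset.card_singleton k⟩, fun k => by simpa using hw _,
      diff_zero_apply _ w⟩
  · rintro ⟨w, hw, hy⟩
    obtain ⟨v, hv⟩ := exists_chain_one w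
    refine ⟨v, ?_, ?_⟩
    · rw [mem_xGrading]
      intro J
      obtain ⟨k, hk⟩ := Finset.card_eq_one.1 J.2
      obtain rfl : J = ⟨{k}, Finset.card_singleton k⟩ := Subtype.ext hk
      rw [hv]
      simpa using hw k
    · refine chain_zero_ext_empty ?_
      rw [diff_zero_apply, hy]
      exact Finset.sum_congr rfl fun k _ => by rw [hv]

theorem torVanishes_zero_iff {j : ℤ} :
    TorVanishes n K 𝒜 0 j ↔ 𝒜 j ≤ xImage n K 𝒜 j := by
  constructor
  · intro h y hy
    have := h (fun _ => y) (by rw [mem_xGrading]; simpa using hy) trivial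
    rwa [exists_xDiff_zero_iff] at this
  · intro h z hz _
    rw [exists_xDiff_zero_iff]
    rw [mem_xGrading] at hz
    exact h (by simpa using hz ⟨∅, rfl⟩)

theorem const_mem_xCycles {m : A} (hX : ∀ k, (X k : MvPolynomial (Fin n) K) • m = 0) (i : ℕ) :
    (fun _ => m) ∈ xCycles n K A i := by
  cases i with
  | zero => trivial
  | succ i =>
    refine mem_cycles_of_diff_eq_zero ?_
    funext J
    change ∑ k : {k : Fin n // k ∉ J.1}, (sgn (MvPolynomial (Fin n) K) k.1 J.1 * X k.1) • m = 0
    exact Finset.sum_eq_zero fun k _ => by rw [mul_smul, hX, smul_zero]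

/-- Nonvanishing of `Tor_n` detects the socle. -/
theorem eq_zero_of_torVanishes_top {j : ℤ} (h : TorVanishes n K 𝒜 n (j + n)) {m : A}
    (hm : m ∈ 𝒜 j) (hX : ∀ k, (X k : MvPolynomial (Fin n) K) • m = 0) : m = 0 := by
  -- There is one index set of size `n`, so the constant family is the chain `e_0 ∧ … ∧ e_{n-1} ⊗
  -- m`. It is a cycle because the variables kill `m`, and no nonzero chain of degree `n + 1` can
  -- bound it.
  obtain ⟨w, -, hw⟩ := h (fun _ => m) (by rw [mem_xGrading]; simpa using fun _ _ => hm) (const_mem_xCycles hX n)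
  rw [eq_zero_of_lt (Nat.lt_succ_self n) w, map_zero] at hw
  exact (congrFun hw ⟨Finset.univ, Finset.card_fin n⟩).symm

end TorVanishing

/-! ### Regularity bounds and socle bounds in short exact sequences. -/

section Regularity

variable {n : ℕ} {K : Type*} [Field K]
  {A : Type*} [AddCommGroup A] [Module (MvPolynomial (Fin n) K) A]
  {B : Type*} [AddCommGroup B] [Module (MvPolynomial (Fin n) K) B]
  {C : Type*} [AddCommGroup C] [Module (MvPolynomial (Fin n) K) C]
  {𝒜 : ℤ → AddSubgroup A} {ℬ : ℤ → AddSubgroup B} {𝒞 : ℤ → AddSubgroup C}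

variable (n K) in
/-- The regularity is at most `a`, in terms of the Koszul homology of the variables. -/
def RegLE (𝒜 : ℤ → AddSubgroup A) (a : ℤ) : Prop :=
  ∀ (i : ℕ) (j : ℤ), a < j - i → TorVanishes n K 𝒜 i j

variable (n K) in
/-- The bound `RegLE` for `Tor_n` only. -/
def SocleLE (𝒜 : ℤ → AddSubgroup A) (a : ℤ) : Prop :=
  ∀ j : ℤ, a < j - n → TorVanishes n K 𝒜 n j

theorem RegLE.mono {a b : ℤ} (h : RegLE n K 𝒜 a) (hab : a ≤ b) : RegLE n K 𝒜 b :=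
  fun i j hj => h i j (hab.trans_lt hj)

theorem SocleLE.mono {a b : ℤ} (h : SocleLE n K 𝒜 a) (hab : a ≤ b) : SocleLE n K 𝒜 b :=
  fun j hj => h j (hab.trans_lt hj)

theorem RegLE.socleLE {a : ℤ} (h : RegLE n K 𝒜 a) : SocleLE n K 𝒜 a := fun j hj => h n j hj

theorem regLE_of_piece_eq_bot {a : ℤ} (h : ∀ j, a < j → 𝒜 j = ⊥) : RegLE n K 𝒜 a :=
  fun _ _ hj => torVanishes_of_piece_eq_bot (h _ hj)

/-- A family of pieces that vanishes in large degrees vanishes above the degrees of its socle. -/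
theorem SocleLE.piece_eq_bot {a σ : ℤ} (h𝒜 : XStable n K 𝒜) (h : SocleLE n K 𝒜 a)
    (hσ : ∀ j, σ < j → 𝒜 j = ⊥) (j : ℤ) (hj : a < j) : 𝒜 j = ⊥ := by
  -- Descending induction on the degree: if the piece in degree `j + 1` is zero, every element of
  -- degree `j` lies in the socle.
  obtain ⟨k, hk⟩ : ∃ k : ℕ, σ < j + k := ⟨(σ - j + 1).toNat, by omega⟩
  induction k generalizing j with
  | zero => exact hσ j (by simpa using hk)
  | succ k ih =>
    have h1 := ih (j + 1) (by omega) (by push_cast at hk; omega)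
    rw [AddSubgroup.eq_bot_iff_forall]
    intro m hm
    refine eq_zero_of_torVanishes_top (h (j + n) (by omega)) hm fun k => ?_
    have := h𝒜 k j m hm
    rwa [h1, AddSubgroup.mem_bot] at this

namespace PieceExact

variable {f : A →ₗ[MvPolynomial (Fin n) K] B} {g : B →ₗ[MvPolynomial (Fin n) K] C}
  (E : PieceExact n K 𝒜 ℬ 𝒞 f g)
include E

theorem regLE_middle (h𝒜 : XStable n K 𝒜) (hℬ : XStable n K ℬ) {a : ℤ} (hA : RegLE n K 𝒜 a)
    (hC : RegLE n K 𝒞 a) : RegLE n K ℬ a :=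
  fun i j hj => E.torVanishes_middle h𝒜 hℬ (hA i j hj) (hC i j hj)

theorem regLE_left (h𝒜 : XStable n K 𝒜) (hℬ : XStable n K ℬ) {a : ℤ} (hB : RegLE n K ℬ a)
    (hC : RegLE n K 𝒞 (a - 1)) : RegLE n K 𝒜 a :=
  fun i j hj => E.torVanishes_left h𝒜 hℬ (hB i j hj) (hC (i + 1) j (by push_cast; omega))

theorem regLE_right (h𝒜 : XStable n K 𝒜) (hℬ : XStable n K ℬ) {a : ℤ} (hB : RegLE n K ℬ a)
    (hA : RegLE n K 𝒜 (a + 1)) : RegLE n K 𝒞 a := by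
  intro i j hj
  cases i with
  | zero => exact E.torVanishes_zero_right (hB 0 j hj)
  | succ i =>
    exact E.torVanishes_right h𝒜 hℬ (hB _ j hj) (hA i j (by push_cast at hj; omega))

/-- `Tor_n` is left exact because `Tor_{n+1}` vanishes. -/
theorem socleLE_left (h𝒜 : XStable n K 𝒜) (hℬ : XStable n K ℬ) {a : ℤ}
    (hB : SocleLE n K ℬ a) : SocleLE n K 𝒜 a :=
  fun j hj => E.torVanishes_left h𝒜 hℬ (hB j hj) (torVanishes_of_lt (Nat.lt_succ_self n) j)

/-- From `Tor_n(B) → Tor_n(C) → Tor_{n-1}(A)`: the homological index drops by one, so the bound on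
`A` may be larger by one. For `n = 0` the third term is missing, which `key` accounts for. -/
theorem socleLE_right (h𝒜 : XStable n K 𝒜) (hℬ : XStable n K ℬ) {a : ℤ}
    (hB : SocleLE n K ℬ a) (hA : RegLE n K 𝒜 (a + 1)) : SocleLE n K 𝒞 a := by
  intro j hj
  have key : ∀ i, TorVanishes n K ℬ i j → (∀ i', i = i' + 1 → TorVanishes n K 𝒜 i' j) →
      TorVanishes n K 𝒞 i j := by
    intro i h1 h2
    cases i with
    | zero => exact E.torVanishes_zero_right h1
    | succ i => exact E.torVanishes_right h𝒜 hℬ h1 (h2 i rfl)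
  exact key n (hB j hj) fun i hi => hA i j (by omega)

end PieceExact

end Regularity

/-! ### Homogeneous components, generators and preimages. -/

section Graded

variable {n : ℕ} {K : Type*} [Field K] {A : Type*} [AddCommGroup A]

/-- Projections onto the pieces of a grading. -/
structure GradedPieces (𝒜 : ℤ → AddSubgroup A) where
  proj : ℤ → A →+ A
  proj_mem : ∀ j a, proj j a ∈ 𝒜 j
  proj_of_mem : ∀ {j a}, a ∈ 𝒜 j → proj j a = a
  proj_of_ne : ∀ {i j a}, a ∈ 𝒜 i → i ≠ j → proj j a = 0
  exists_sum : ∀ a, ∃ s : Finset ℤ, ∀ s', s ⊆ s' → ∑ j ∈ s', proj j a = a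

/-- The pieces are independent. -/
def Independent (𝒜 : ℤ → AddSubgroup A) : Prop :=
  ∀ (s : Finset ℤ) (f : ℤ → A), (∀ j ∈ s, f j ∈ 𝒜 j) → ∑ j ∈ s, f j = 0 → ∀ j ∈ s, f j = 0

theorem GradedPieces.independent {𝒜 : ℤ → AddSubgroup A} (G : GradedPieces 𝒜) :
    Independent 𝒜 := by
  intro s f hf h j hj
  have h1 := congrArg (G.proj j) h
  rw [map_sum, map_zero, Finset.sum_eq_single j] at h1
  · rwa [G.proj_of_mem (hf j hj)] at h1
  · exact fun i hi hij => G.proj_of_ne (hf i hi) hij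
  · exact fun h => absurd hj h

theorem Independent.of_injective {B : Type*} [AddCommGroup B] {𝒜 : ℤ → AddSubgroup A}
    {ℬ : ℤ → AddSubgroup B} (h : Independent ℬ) (g : A →+ B)
    (hmem : ∀ {j a}, a ∈ 𝒜 j → g a ∈ ℬ j) (hinj : ∀ {j a}, a ∈ 𝒜 j → g a = 0 → a = 0) :
    Independent 𝒜 := by
  intro s f hf h0 j hj
  refine hinj (hf j hj) (h s (fun j => g (f j)) (fun i hi => hmem (hf i hi)) ?_ j hj)
  rw [← map_sum, h0, map_zero]

/-- A graded abelian group in the sense of `DirectSum.IsInternal` has projections. -/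
noncomputable def GradedPieces.ofIsInternal {𝒜 : ℤ → AddSubgroup A}
    (h : DirectSum.IsInternal 𝒜) : GradedPieces 𝒜 :=
  letI := h.chooseDecomposition
  { proj := fun j => (𝒜 j).subtype.comp ((DFinsupp.evalAddMonoidHom j).comp
      (DirectSum.decomposeAddEquiv 𝒜).toAddMonoidHom)
    proj_mem := fun j a => ((DirectSum.decompose 𝒜 a) j).2
    proj_of_mem := fun {j a} ha => DirectSum.decompose_of_mem_same 𝒜 ha
    proj_of_ne := fun {i j a} ha hij => DirectSum.decompose_of_mem_ne 𝒜 ha hij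
    exists_sum := fun a => by
      classical
      refine ⟨(DirectSum.decompose 𝒜 a).support, fun s' hs => ?_⟩
      conv_rhs => rw [← DirectSum.sum_support_decompose 𝒜 a]
      refine (Finset.sum_subset hs fun j _ hj => ?_).symm
      have : (DirectSum.decompose 𝒜 a) j = 0 := by simpa using hj
      exact congrArg Subtype.val this }

/-- Projections for a finite product of shifted copies. -/
def GradedPieces.pi {𝒜 : ℤ → AddSubgroup A} (G : GradedPieces 𝒜) {ι : Type*} [Finite ι]
    (s : ι → ℤ) : GradedPieces (piGrading 𝒜 s) where
  proj j :=
    { toFun := fun z i => G.proj (j - s i) (z i)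
      map_zero' := by funext i; simp
      map_add' := fun x y => by funext i; simp }
  proj_mem j a i := G.proj_mem _ _
  proj_of_mem {j a} ha := funext fun i => G.proj_of_mem (ha i)
  proj_of_ne {i j a} ha hij := funext fun k => G.proj_of_ne (ha k) (by simpa using hij)
  exists_sum z := by
    classical
    have := Fintype.ofFinite ι
    choose t ht using fun i => G.exists_sum (z i)
    refine ⟨Finset.univ.biUnion fun i => (t i).map (Equiv.addRight (s i)).toEmbedding,
      fun s' hs => ?_⟩
    funext i
    rw [Finset.sum_apply]
    have h1 := ht i (s'.map (Equiv.subRight (s i)).toEmbedding) (by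
      intro j hj
      rw [Finset.mem_map]
      refine ⟨j + s i, hs ?_, by simp⟩
      rw [Finset.mem_biUnion]
      exact ⟨i, Finset.mem_univ i, Finset.mem_map.2 ⟨j, hj, rfl⟩⟩)
    rw [Finset.sum_map] at h1
    exact h1

variable [Module (MvPolynomial (Fin n) K) A]

variable (n K) in
/-- Homogeneous polynomials act by shifting degrees. -/
def SMulStable (𝒜 : ℤ → AddSubgroup A) : Prop :=
  ∀ (i : ℕ) (j : ℤ) (f : MvPolynomial (Fin n) K) (m : A),
    f.IsHomogeneous i → m ∈ 𝒜 j → f • m ∈ 𝒜 (i + j)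

theorem SMulStable.xStable {𝒜 : ℤ → AddSubgroup A} (h : SMulStable n K 𝒜) : XStable n K 𝒜 := by
  intro k j m hm
  have := h 1 j (X k) m (isHomogeneous_X K k) hm
  rwa [Nat.cast_one, add_comm] at this

theorem SMulStable.pi {𝒜 : ℤ → AddSubgroup A} (h : SMulStable n K 𝒜) {ι : Type*} (s : ι → ℤ) :
    SMulStable n K (piGrading 𝒜 s) := by
  intro i j f m hf hm k
  rw [add_sub_assoc]
  exact h i _ f _ hf (hm k)

theorem isHomogeneousInt_natCast {p : MvPolynomial (Fin n) K} {i : ℕ} :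
    IsHomogeneousInt p (i : ℤ) ↔ p.IsHomogeneous i := by
  simp only [IsHomogeneousInt, Nat.cast_inj]
  constructor
  · intro h m hm
    have := h m (mem_support_iff.2 hm)
    rwa [Finsupp.degree_eq_weight_one] at this
  · intro h m hm
    have := h (mem_support_iff.1 hm)
    rwa [Finsupp.degree_eq_weight_one]

theorem IsHomogeneousInt.eq_zero_of_neg {p : MvPolynomial (Fin n) K} {z : ℤ}
    (h : IsHomogeneousInt p z) (hz : z < 0) : p = 0 := by
  rw [← support_eq_empty, Finset.eq_empty_iff_forall_notMem]
  intro m hm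
  have := h m hm
  omega

theorem SMulStable.smul_mem {𝒜 : ℤ → AddSubgroup A} (h : SMulStable n K 𝒜)
    {p : MvPolynomial (Fin n) K} {z j : ℤ} {m : A} (hp : IsHomogeneousInt p z) (hm : m ∈ 𝒜 j) :
    p • m ∈ 𝒜 (z + j) := by
  rcases lt_or_ge z 0 with hz | hz
  · rw [hp.eq_zero_of_neg hz, zero_smul]
    exact AddSubgroup.zero_mem _
  · lift z to ℕ using hz
    exact h z j p m (isHomogeneousInt_natCast.1 hp) hm

variable (n K) in
/-- The standard grading of the polynomial ring, indexed by the integers. -/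
def polyGrading (z : ℤ) : AddSubgroup (MvPolynomial (Fin n) K) where
  carrier := {p | IsHomogeneousInt p z}
  zero_mem' := fun m hm => by simp at hm
  add_mem' := by
    intro p q hp hq m hm
    classical
    rcases Finset.mem_union.1 (support_add hm) with h | h
    · exact hp m h
    · exact hq m h
  neg_mem' := by
    intro p hp m hm
    exact hp m (by rwa [support_neg] at hm)

theorem mem_polyGrading {p : MvPolynomial (Fin n) K} {z : ℤ} :
    p ∈ polyGrading n K z ↔ IsHomogeneousInt p z := Iff.rfl

theorem smulStable_polyGrading : SMulStable n K (polyGrading n K) := by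
  intro i j f m hf hm
  rw [mem_polyGrading] at hm ⊢
  rcases lt_or_ge j 0 with hj | hj
  · rw [hm.eq_zero_of_neg hj, smul_zero]
    exact (polyGrading n K _).zero_mem
  · lift j to ℕ using hj
    rw [isHomogeneousInt_natCast] at hm
    exact_mod_cast isHomogeneousInt_natCast.2 (hf.mul hm)

variable (n K) in
/-- The homogeneous components of a polynomial. -/
noncomputable def polyPieces : GradedPieces (polyGrading n K) where
  proj z := if 0 ≤ z then (homogeneousComponent z.toNat).toAddMonoidHom else 0
  proj_mem z p := by
    split_ifs with hz
    · lift z to ℕ using hz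
      exact isHomogeneousInt_natCast.2 (homogeneousComponent_isHomogeneous _ _)
    · exact (polyGrading n K z).zero_mem
  proj_of_mem {z p} hp := by
    rw [mem_polyGrading] at hp
    split_ifs with hz
    · lift z to ℕ using hz
      rw [isHomogeneousInt_natCast] at hp
      exact homogeneousComponent_eq_self hp
    · rw [hp.eq_zero_of_neg (not_le.1 hz), map_zero]
  proj_of_ne {i j p} hp hij := by
    rw [mem_polyGrading] at hp
    split_ifs with hz
    · lift j to ℕ using hz
      rcases lt_or_ge i 0 with hi | hi
      · rw [hp.eq_zero_of_neg hi, map_zero]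
      · lift i to ℕ using hi
        rw [isHomogeneousInt_natCast] at hp
        refine (homogeneousComponent_of_mem hp).trans (if_neg ?_)
        simp only [Int.toNat_natCast]
        exact_mod_cast hij.symm
    · rfl
  exists_sum p := by
    refine ⟨(Finset.range (p.totalDegree + 1)).map Nat.castEmbedding, fun s' hs => ?_⟩
    rw [← Finset.sum_subset hs]
    · rw [Finset.sum_map]
      conv_rhs => rw [← sum_homogeneousComponent p]
      refine Finset.sum_congr rfl fun i _ => ?_
      simp
    · intro z _ hz
      split_ifs with h
      · lift z to ℕ using h
        refine homogeneousComponent_eq_zero _ _ ?_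
        by_contra h
        refine hz (Finset.mem_map.2 ⟨z, ?_, rfl⟩)
        simp at h ⊢
        omega
      · rfl

namespace GradedPieces

variable {𝒜 : ℤ → AddSubgroup A} (G : GradedPieces 𝒜)

theorem exists_sum_mem (a : A) (j : ℤ) : ∃ s : Finset ℤ, j ∈ s ∧ ∑ i ∈ s, G.proj i a = a := by
  classical
  obtain ⟨s, hs⟩ := G.exists_sum a
  exact ⟨insert j s, Finset.mem_insert_self _ _, hs _ (Finset.subset_insert _ _)⟩

theorem proj_smul (h : SMulStable n K 𝒜) {p : MvPolynomial (Fin n) K} {z : ℤ}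
    (hp : IsHomogeneousInt p z) (j : ℤ) (a : A) : G.proj (z + j) (p • a) = p • G.proj j a := by
  obtain ⟨s, hjs, hs⟩ := G.exists_sum_mem a j
  conv_lhs => rw [← hs]
  rw [Finset.smul_sum, map_sum, Finset.sum_eq_single j]
  · exact G.proj_of_mem (h.smul_mem hp (G.proj_mem j a))
  · intro i _ hij
    exact G.proj_of_ne (h.smul_mem hp (G.proj_mem i a)) (by simpa using hij)
  · exact fun h => absurd hjs h

theorem proj_smul_of_mem (h : SMulStable n K 𝒜) (p : MvPolynomial (Fin n) K) {e : ℤ} {a : A}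
    (ha : a ∈ 𝒜 e) (j : ℤ) : G.proj j (p • a) = (polyPieces n K).proj (j - e) p • a := by
  obtain ⟨s, hjs, hs⟩ := (polyPieces n K).exists_sum_mem p (j - e)
  conv_lhs => rw [← hs]
  rw [Finset.sum_smul, map_sum, Finset.sum_eq_single (j - e)]
  · refine G.proj_of_mem ?_
    have := h.smul_mem ((polyPieces n K).proj_mem (j - e) p) ha
    rwa [sub_add_cancel] at this
  · intro i _ hij
    refine G.proj_of_ne (h.smul_mem ((polyPieces n K).proj_mem i p) ha) ?_
    rintro rfl
    simp at hij
  · exact fun h => absurd hjs h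

/-- A finitely generated homogeneous submodule has finitely many homogeneous generators. -/
theorem exists_homogeneous_generators {R : Submodule (MvPolynomial (Fin n) K) A} (hfg : R.FG)
    (hR : ∀ j, ∀ a ∈ R, G.proj j a ∈ R) :
    ∃ (N : ℕ) (g : Fin N → A) (e : Fin N → ℤ), (∀ k, g k ∈ 𝒜 (e k)) ∧
      Submodule.span (MvPolynomial (Fin n) K) (Set.range g) = R := by
  obtain ⟨T, hT⟩ := hfg
  choose s hs using G.exists_sum
  let I := T.sigma s
  let φ := I.equivFin.symm
  refine ⟨I.card, fun k => G.proj (φ k).1.2 (φ k).1.1, fun k => (φ k).1.2,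
    fun k => G.proj_mem _ _, le_antisymm ?_ ?_⟩
  · rw [Submodule.span_le]
    rintro _ ⟨k, rfl⟩
    refine hR _ _ ?_
    rw [← hT]
    exact Submodule.subset_span (Finset.mem_sigma.1 (φ k).2).1
  · rw [← hT, Submodule.span_le]
    intro a ha
    rw [SetLike.mem_coe, ← hs a (s a) subset_rfl]
    refine Submodule.sum_mem _ fun j hj => Submodule.subset_span ?_
    refine ⟨φ.symm ⟨⟨a, j⟩, Finset.mem_sigma.2 ⟨ha, hj⟩⟩, ?_⟩
    simp

include G in
theorem exists_homogeneous_coeffs (h : SMulStable n K 𝒜) {N : ℕ} {g : Fin N → A} {e : Fin N → ℤ}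
    (hg : ∀ k, g k ∈ 𝒜 (e k)) {j : ℤ} {a : A} (ha : a ∈ 𝒜 j)
    (hspan : a ∈ Submodule.span (MvPolynomial (Fin n) K) (Set.range g)) :
    ∃ p : Fin N → MvPolynomial (Fin n) K, (∀ k, IsHomogeneousInt (p k) (j - e k)) ∧
      a = ∑ k, p k • g k := by
  obtain ⟨c, hc⟩ := (Submodule.mem_span_range_iff_exists_fun _).1 hspan
  refine ⟨fun k => (polyPieces n K).proj (j - e k) (c k), fun k => (polyPieces n K).proj_mem _ _,
    ?_⟩
  conv_lhs => rw [← G.proj_of_mem ha, ← hc]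
  rw [map_sum]
  exact Finset.sum_congr rfl fun k _ => G.proj_smul_of_mem h _ (hg k) j

end GradedPieces

variable (n K) in
/-- The pieces of the graded free module with basis elements of degrees `s`. -/
noncomputable abbrev freeGrading {N : ℕ} (s : Fin N → ℤ) (j : ℤ) : AddSubgroup (Fin N → MvPolynomial (Fin n) K) :=
  piGrading (polyGrading n K) s j

theorem map_mem_of_mem_freeGrading {𝒜 : ℤ → AddSubgroup A} (h : SMulStable n K 𝒜) {N : ℕ}
    {s : Fin N → ℤ} {g : (Fin N → MvPolynomial (Fin n) K) →ₗ[MvPolynomial (Fin n) K] A}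
    (hg : ∀ k, g (Pi.single k 1) ∈ 𝒜 (s k)) {j : ℤ} {p : Fin N → MvPolynomial (Fin n) K}
    (hp : p ∈ freeGrading n K s j) : g p ∈ 𝒜 j := by
  rw [LinearMap.pi_apply_eq_sum_univ g p]
  refine AddSubgroup.sum_mem _ fun k _ => ?_
  have h1 := h.smul_mem (hp k) (hg k)
  rw [sub_add_cancel] at h1
  convert h1 using 3
  ext l
  simp [Pi.single_apply, eq_comm]

/-- Homogeneous elements in the image of a graded free module have homogeneous preimages. -/
theorem exists_homogeneous_preimage {𝒜 : ℤ → AddSubgroup A} (h : SMulStable n K 𝒜)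
    (hind : Independent 𝒜) {N : ℕ} {s : Fin N → ℤ}
    {g : (Fin N → MvPolynomial (Fin n) K) →ₗ[MvPolynomial (Fin n) K] A}
    (hg : ∀ k, g (Pi.single k 1) ∈ 𝒜 (s k)) {j : ℤ} (p : Fin N → MvPolynomial (Fin n) K)
    (hp : g p ∈ 𝒜 j) : ∃ q ∈ freeGrading n K s j, g q = g p := by
  let G := (polyPieces n K).pi s
  obtain ⟨t, hjt, ht⟩ := G.exists_sum_mem p j
  refine ⟨G.proj j p, G.proj_mem j p, ?_⟩
  -- The images of the components of `p` add up to `g p`, which is itself of degree `j`. Subtracting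
  -- it from the `j`-th image yields homogeneous elements with sum zero.
  have h1 := hind t (fun i => g (G.proj i p) - if i = j then g p else 0) (by
    intro i _
    refine (𝒜 i).sub_mem (map_mem_of_mem_freeGrading h hg (G.proj_mem i p)) ?_
    split_ifs with hij
    · rwa [hij]
    · exact (𝒜 i).zero_mem) (by
    rw [Finset.sum_sub_distrib, ← map_sum, ht, Finset.sum_ite_eq', if_pos hjt, sub_self]) j hjt
  simpa [sub_eq_zero] using h1

end Graded

/-! ### Homogeneous boundaries bound homogeneous chains. -/

section HomogeneousBoundaries

variable {n : ℕ} {K : Type*} [Field K] {A : Type*} [AddCommGroup A]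
  [Module (MvPolynomial (Fin n) K) A] {𝒜 : ℤ → AddSubgroup A} (G : GradedPieces 𝒜)
  {r : ℕ} {u : Fin r → MvPolynomial (Fin n) K} {d : Fin r → ℕ}

/-- The homogeneous components of a Koszul chain. -/
abbrev GradedPieces.chain (d : Fin r → ℕ) (t : ℕ) : GradedPieces (chainGrading d 𝒜 t) :=
  G.pi fun J : {J : Finset (Fin r) // J.card = t} => ∑ k ∈ J.1, (d k : ℤ)

theorem diff_proj (h𝒜 : SMulStable n K 𝒜) (hu : ∀ k, (u k).IsHomogeneous (d k)) (t : ℕ) (j : ℤ)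
    (z : Chain r (t + 1) A) :
    diff u A t ((G.chain d (t + 1)).proj j z) = (G.chain d t).proj j (diff u A t z) := by
  funext J
  change ∑ k : {k : Fin r // k ∉ J.1}, (sgn _ k.1 J.1 * u k.1) •
      G.proj (j - ∑ l ∈ (ins J k).1, (d l : ℤ)) (z (ins J k)) =
    G.proj (j - ∑ l ∈ J.1, (d l : ℤ))
      (∑ k : {k : Fin r // k ∉ J.1}, (sgn _ k.1 J.1 * u k.1) • z (ins J k))
  rw [map_sum]
  refine Finset.sum_congr rfl fun k _ => ?_
  have h1 : IsHomogeneousInt (sgn (MvPolynomial (Fin n) K) k.1 J.1 * u k.1) (d k.1) := by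
    refine sgn_mul_smul_mem (polyGrading n K (d k.1)) k.1 J.1 (m := (1 : MvPolynomial (Fin n) K))
      (a := u k.1) ?_ |> fun h => by rwa [smul_eq_mul, mul_one] at h
    rw [smul_eq_mul, mul_one]
    exact isHomogeneousInt_natCast.2 (hu k.1)
  rw [← G.proj_smul h𝒜 h1]
  congr 2
  rw [show ∑ l ∈ (ins J k).1, (d l : ℤ) = d k.1 + ∑ l ∈ J.1, (d l : ℤ) from Finset.sum_insert k.2]
  ring

include G in
theorem exists_homogeneous_of_mem_boundaries (h𝒜 : SMulStable n K 𝒜)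
    (hu : ∀ k, (u k).IsHomogeneous (d k)) {t : ℕ} {j : ℤ} {z : Chain r t A}
    (hz : z ∈ chainGrading d 𝒜 t j) (hzb : z ∈ boundaries u A t) :
    ∃ w ∈ chainGrading d 𝒜 (t + 1) j, diff u A t w = z := by
  obtain ⟨w, rfl⟩ := hzb
  refine ⟨_, (G.chain d (t + 1)).proj_mem j w, ?_⟩
  rw [diff_proj G h𝒜 hu, (G.chain d t).proj_of_mem hz]

end HomogeneousBoundaries

/-! ### The variables form a regular sequence; free modules have no higher `Tor`. -/

section PolynomialRing

variable {n : ℕ} {K : Type*} [Field K]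

/-- Stated for the first `m` variables so that induction on `m` with `acyclic_succ` applies. -/
theorem cycles_X_le_boundaries (m : ℕ) (h : m ≤ n) (t : ℕ) :
    cycles (fun k : Fin m => (X (Fin.castLE h k) : MvPolynomial (Fin n) K))
      (MvPolynomial (Fin n) K) (t + 1) ≤
    boundaries (fun k : Fin m => (X (Fin.castLE h k) : MvPolynomial (Fin n) K))
      (MvPolynomial (Fin n) K) (t + 1) := by
  induction m generalizing t with
  | zero =>
    intro z _
    rw [eq_zero_of_lt (Nat.succ_pos t) z]
    exact Submodule.zero_mem _
  | succ m ih =>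
    refine acyclic_succ (fun k : Fin (m + 1) => (X (Fin.castLE h k) : MvPolynomial (Fin n) K))
      (fun t => ih (Nat.le_of_succ_le h) t) (fun w hw => ?_) t
    -- Membership in `(X_0, …, X_{m-1})` is tested on monomials, and multiplication by `X_m` leaves
    -- the exponents of the earlier variables unchanged.
    have key : ∀ y : Chain m 0 (MvPolynomial (Fin n) K),
        y ∈ boundaries (fun k : Fin m => (X (Fin.castLE (Nat.le_of_succ_le h) k) :
          MvPolynomial (Fin n) K)) (MvPolynomial (Fin n) K) 0 ↔
        ∀ a ∈ (y ⟨∅, rfl⟩).support, ∃ i : Fin n, i.1 < m ∧ a i ≠ 0 := by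
      intro y
      have h1 : (Set.range fun k : Fin m => (X (Fin.castLE (Nat.le_of_succ_le h) k) :
          MvPolynomial (Fin n) K)) = X '' {i : Fin n | i.1 < m} := by
        ext p
        constructor
        · rintro ⟨k, rfl⟩
          exact ⟨_, k.2, rfl⟩
        · rintro ⟨i, hi, rfl⟩
          exact ⟨⟨i.1, hi⟩, rfl⟩
      have h2 := mem_ideal_span_X_image (R := K) (x := y ⟨∅, rfl⟩) (s := {i : Fin n | i.1 < m})
      rw [← h1, Ideal.mem_span_range_iff_exists_fun] at h2
      rw [mem_boundaries_zero_iff]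
      simp only [smul_eq_mul, mul_comm (X _), Set.mem_ofPred_eq] at h2 ⊢
      rw [← h2]
      simp only [eq_comm]
    refine (key w).2 fun a ha => ?_
    obtain ⟨i, hi, hai⟩ := (key _).1 hw (Finsupp.single ⟨m, h⟩ 1 + a) (by
      rw [mem_support_iff] at ha ⊢
      change coeff _ (X (Fin.castLE h (Fin.last m)) * w ⟨∅, rfl⟩) ≠ 0
      rw [show Fin.castLE h (Fin.last m) = ⟨m, h⟩ from rfl, coeff_X_mul]
      exact ha)
    refine ⟨i, hi, fun h0 => hai ?_⟩
    rw [Finsupp.add_apply, h0, add_zero, Finsupp.single_apply, if_neg]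
    rintro rfl
    exact lt_irrefl _ hi

theorem torVanishes_polyGrading (i : ℕ) (j : ℤ) : TorVanishes n K (polyGrading n K) (i + 1) j := by
  intro z hz hzc
  exact exists_homogeneous_of_mem_boundaries (polyPieces n K) smulStable_polyGrading
    (fun k => isHomogeneous_X K k) hz (cycles_X_le_boundaries n le_rfl i hzc)

theorem mem_xImage_polyGrading {j : ℤ} {p : MvPolynomial (Fin n) K} (hp : IsHomogeneousInt p j)
    (h0 : constantCoeff p = 0) : p ∈ xImage n K (polyGrading n K) j := by
  have h1 : p ∈ Submodule.span (MvPolynomial (Fin n) K)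
      (Set.range (X : Fin n → MvPolynomial (Fin n) K)) := by
    rw [← Set.image_univ]
    refine mem_ideal_span_X_image.2 fun a ha => ?_
    by_contra! h
    have : a = 0 := Finsupp.ext fun i => h i trivial
    rw [this, mem_support_iff] at ha
    exact ha h0
  obtain ⟨c, hc, hpc⟩ := (polyPieces n K).exists_homogeneous_coeffs smulStable_polyGrading
    (e := fun _ => 1) (fun k => isHomogeneousInt_natCast.2 (isHomogeneous_X K k)) hp h1
  refine ⟨c, hc, ?_⟩
  rw [hpc]
  exact Finset.sum_congr rfl fun k _ => by rw [smul_eq_mul, smul_eq_mul, mul_comm]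

theorem mem_xImage_freeGrading {N : ℕ} {s : Fin N → ℤ} {j : ℤ} {p : Fin N → MvPolynomial (Fin n) K}
    (hp : p ∈ freeGrading n K s j) (h0 : ∀ k, constantCoeff (p k) = 0) :
    p ∈ xImage n K (freeGrading n K s) j := by
  choose w hw hpw using fun k => mem_xImage_polyGrading (hp k) (h0 k)
  refine ⟨fun l k => w k l, fun l k => ?_, ?_⟩
  · rw [sub_right_comm]
    exact hw k l
  · funext k
    rw [hpw k, Finset.sum_apply]
    rfl

theorem constantCoeff_eq_zero_of_mem_xImage {N : ℕ} {s : Fin N → ℤ} {j : ℤ}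
    {p : Fin N → MvPolynomial (Fin n) K} (hp : p ∈ xImage n K (freeGrading n K s) j) (k : Fin N) :
    constantCoeff (p k) = 0 := by
  obtain ⟨w, -, rfl⟩ := hp
  simp [Finset.sum_apply]

end PolynomialRing

/-! ### `Tor` from the variables agrees with `Tor` from a graded free resolution. -/

section Comparison

variable {n : ℕ} {K : Type*} [Field K] {A : Type*} [AddCommGroup A]
  [Module (MvPolynomial (Fin n) K) A] {𝒜 : ℤ → AddSubgroup A}

/-- The pieces of the image of a graded free module. -/
noncomputable abbrev imageGrading {N : ℕ} (s : Fin N → ℤ)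
    (g : (Fin N → MvPolynomial (Fin n) K) →ₗ[MvPolynomial (Fin n) K] A) (j : ℤ) : AddSubgroup A :=
  (freeGrading n K s j).map g.toAddMonoidHom

theorem imageGrading_eq (h𝒜 : SMulStable n K 𝒜) (hind : Independent 𝒜) {N : ℕ} {s : Fin N → ℤ}
    {g : (Fin N → MvPolynomial (Fin n) K) →ₗ[MvPolynomial (Fin n) K] A}
    (hg : ∀ k, g (Pi.single k 1) ∈ 𝒜 (s k)) (hsurj : Function.Surjective g) :
    imageGrading s g = 𝒜 := by
  funext j
  ext a
  constructor
  · rintro ⟨p, hp, rfl⟩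
    exact map_mem_of_mem_freeGrading h𝒜 hg hp
  · intro ha
    obtain ⟨p, rfl⟩ := hsurj a
    obtain ⟨q, hq, hqp⟩ := exists_homogeneous_preimage h𝒜 hind hg p ha
    exact ⟨q, hq, hqp⟩

theorem smulStable_freeGrading {N : ℕ} (s : Fin N → ℤ) : SMulStable n K (freeGrading n K s) :=
  smulStable_polyGrading.pi s

theorem xStable_imageGrading {N : ℕ} (s : Fin N → ℤ)
    (g : (Fin N → MvPolynomial (Fin n) K) →ₗ[MvPolynomial (Fin n) K] A) :
    XStable n K (imageGrading s g) := by
  rintro k j _ ⟨p, hp, rfl⟩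
  exact ⟨X k • p, (smulStable_freeGrading s).xStable k j p hp, map_smul g _ _⟩

/-- The entries of `D` have the degrees of a graded map of free modules. -/
def HomogeneousMatrix {N N' : ℕ} (s : Fin N → ℤ) (s' : Fin N' → ℤ)
    (D : Matrix (Fin N) (Fin N') (MvPolynomial (Fin n) K)) : Prop :=
  ∀ l k, IsHomogeneousInt (D l k) (s' k - s l)

variable {N N' N'' : ℕ} {s : Fin N → ℤ} {s' : Fin N' → ℤ} {s'' : Fin N'' → ℤ}
  {D : Matrix (Fin N) (Fin N') (MvPolynomial (Fin n) K)}
  {D' : Matrix (Fin N') (Fin N'') (MvPolynomial (Fin n) K)}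
  {g : (Fin N → MvPolynomial (Fin n) K) →ₗ[MvPolynomial (Fin n) K] A}

theorem HomogeneousMatrix.single_mem (hD : HomogeneousMatrix s s' D) (k : Fin N') :
    D.mulVecLin (Pi.single k 1) ∈ freeGrading n K s (s' k) := by
  intro l
  simpa [mem_polyGrading] using hD l k

theorem pieceExact_imageGrading (hD : HomogeneousMatrix s s' D)
    (hex : Function.Exact D.mulVecLin g) :
    PieceExact n K (imageGrading s' D.mulVecLin) (freeGrading n K s) (imageGrading s g)
      LinearMap.id g where
  f_mem := by
    rintro j _ ⟨p, hp, rfl⟩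
    exact map_mem_of_mem_freeGrading (smulStable_freeGrading s) hD.single_mem hp
  f_inj _ h := h
  g_mem hb := ⟨_, hb, rfl⟩
  g_f := by
    rintro j _ ⟨p, hp, rfl⟩
    exact hex.apply_apply_eq_zero p
  exact := by
    intro j b hb hb0
    obtain ⟨p, rfl⟩ := (hex b).1 hb0
    obtain ⟨q, hq, hqp⟩ := exists_homogeneous_preimage (smulStable_freeGrading s)
      ((polyPieces n K).pi s).independent hD.single_mem p hb
    exact ⟨_, ⟨q, hq, hqp⟩, rfl⟩
  surj := by
    rintro j _ ⟨p, hp, rfl⟩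
    exact ⟨p, hp, rfl⟩

theorem torVanishes_freeGrading (s : Fin N → ℤ) (i : ℕ) (j : ℤ) :
    TorVanishes n K (freeGrading n K s) (i + 1) j :=
  torVanishes_piGrading fun k => torVanishes_polyGrading i (j - s k)

/-- Dimension shifting along `0 → im D → F → im g → 0`, where `F` is free. -/
theorem torVanishes_imageGrading_succ_iff (hD : HomogeneousMatrix s s' D)
    (hex : Function.Exact D.mulVecLin g) {i : ℕ} {j : ℤ} :
    TorVanishes n K (imageGrading s g) (i + 2) j ↔
      TorVanishes n K (imageGrading s' D.mulVecLin) (i + 1) j :=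
  ⟨fun h => (pieceExact_imageGrading hD hex).torVanishes_left (xStable_imageGrading _ _)
      (smulStable_freeGrading s).xStable (torVanishes_freeGrading s i j) h,
    fun h => (pieceExact_imageGrading hD hex).torVanishes_right (xStable_imageGrading _ _)
      (smulStable_freeGrading s).xStable (torVanishes_freeGrading s (i + 1) j) h⟩

/-- `Tor_1(im g)` is the kernel of `im D / 𝔪 im D → F / 𝔪 F`, since `Tor_1(F) = 0`. -/
theorem torVanishes_imageGrading_one_iff (hD : HomogeneousMatrix s s' D)
    (hex : Function.Exact D.mulVecLin g) {j : ℤ} :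
    TorVanishes n K (imageGrading s g) 1 j ↔
      ∀ y ∈ imageGrading s' D.mulVecLin j, y ∈ xImage n K (freeGrading n K s) j →
        y ∈ xImage n K (imageGrading s' D.mulVecLin) j := by
  have E := pieceExact_imageGrading hD hex
  constructor
  · intro h y hy hyx
    obtain ⟨b, hb, hby⟩ := exists_xDiff_zero_iff (y := fun _ => y).2 hyx
    have := E.inj_of_torVanishes_right (xStable_imageGrading _ _)
      (smulStable_freeGrading s).xStable h (a := fun _ => y)
      (by rw [mem_xGrading]; simpa using hy) hb hby
    rwa [exists_xDiff_zero_iff] at this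
  · intro h
    refine E.torVanishes_right_of_inj (xStable_imageGrading _ _)
      (smulStable_freeGrading s).xStable (torVanishes_freeGrading s 0 j) ?_
    intro a ha _ hb
    rw [exists_xDiff_zero_iff] at hb ⊢
    rw [mem_xGrading] at ha
    exact h _ (by simpa using ha ⟨∅, rfl⟩) hb

/-- The constant vectors of degree `j`. -/
theorem C_comp_mem_freeGrading {x : Fin N → K} {j : ℤ} (hx : ∀ k, s k ≠ j → x k = 0) :
    (fun k => (C (x k) : MvPolynomial (Fin n) K)) ∈ freeGrading n K s j := by
  intro k
  by_cases h : s k = j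
  · rw [h, sub_self]
    exact isHomogeneousInt_natCast.2 (isHomogeneous_C _ _)
  · simp only [hx k h, map_zero]
    exact AddSubgroup.zero_mem _

theorem constantCoeff_eq_zero_of_ne {p : MvPolynomial (Fin n) K} {z : ℤ} (hp : IsHomogeneousInt p z)
    (hz : z ≠ 0) : constantCoeff p = 0 := by
  by_contra h
  refine hz ?_
  have := hp 0 (mem_support_iff.2 h)
  simpa using this.symm

theorem constantCoeff_mulVec (D : Matrix (Fin N) (Fin N') (MvPolynomial (Fin n) K))
    (p : Fin N' → MvPolynomial (Fin n) K) (l : Fin N) :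
    constantCoeff (D.mulVecLin p l) =
      (D.map constantCoeff).mulVecLin (fun k => constantCoeff (p k)) l := by
  simp [Matrix.mulVec, dotProduct]

theorem exists_sub_mem_xImage {j : ℤ} {y : A} (hy : y ∈ imageGrading s g j) :
    ∃ x : Fin N → K, (∀ k, s k ≠ j → x k = 0) ∧
      y - g (fun k => C (x k)) ∈ xImage n K (imageGrading s g) j := by
  obtain ⟨p, hp, rfl⟩ := hy
  have hx : ∀ k, s k ≠ j → constantCoeff (p k) = 0 := fun k hk =>
    constantCoeff_eq_zero_of_ne (hp k) (sub_ne_zero.2 hk.symm)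
  refine ⟨fun k => constantCoeff (p k), hx, ?_⟩
  obtain ⟨w, hw, hpw⟩ := mem_xImage_freeGrading
    ((freeGrading n K s j).sub_mem hp (C_comp_mem_freeGrading hx)) (by simp)
  refine ⟨fun l => g (w l), fun l => ⟨_, hw l, rfl⟩, ?_⟩
  have := congrArg g hpw
  simp only [map_sub, map_sum, map_smul] at this
  exact this

/-- Right exactness of reduction modulo `𝔪`: the kernel of `F ⊗ K → im g ⊗ K` is the image of `D ⊗
K`. -/
theorem map_C_mem_xImage_iff (hD : HomogeneousMatrix s s' D)
    (hex : Function.Exact D.mulVecLin g) {j : ℤ} {x : Fin N → K} (hx : ∀ k, s k ≠ j → x k = 0) :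
    g (fun k => C (x k)) ∈ xImage n K (imageGrading s g) j ↔
      x ∈ LinearMap.range (D.map constantCoeff).mulVecLin := by
  constructor
  · rintro ⟨w, hw, hxw⟩
    choose q hq hqw using hw
    have h1 : g ((fun k => C (x k)) - ∑ l, (X l : MvPolynomial (Fin n) K) • q l) = 0 := by
      rw [map_sub, hxw, map_sum, sub_eq_zero]
      refine Finset.sum_congr rfl fun l _ => ?_
      rw [map_smul, ← hqw l]
      rfl
    obtain ⟨v, hv⟩ := (hex _).1 h1
    refine ⟨fun k => constantCoeff (v k), funext fun l => ?_⟩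
    rw [← constantCoeff_mulVec, hv]
    simp [Finset.sum_apply]
  · rintro ⟨y, rfl⟩
    -- A nonzero constant entry of `D` joins basis elements of equal degree, so only the degree `j`
    -- part of `y` contributes.
    let y' : Fin N' → K := fun k => if s' k = j then y k else 0
    have hy' : ∀ k, s' k ≠ j → y' k = 0 := fun k hk => if_neg hk
    have hyy : (D.map constantCoeff).mulVecLin y = (D.map constantCoeff).mulVecLin y' := by
      funext l
      by_cases hl : s l = j
      · simp only [Matrix.mulVecLin_apply, Matrix.mulVec, dotProduct, Matrix.map_apply, y']
        refine Finset.sum_congr rfl fun k _ => ?_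
        split_ifs with hk
        · rfl
        · rw [constantCoeff_eq_zero_of_ne (hD l k) (by rw [hl, sub_ne_zero]; exact hk), zero_mul,
            zero_mul]
      · rw [hx l hl]
        simp only [Matrix.mulVecLin_apply, Matrix.mulVec, dotProduct, Matrix.map_apply, y']
        refine (Finset.sum_eq_zero fun k _ => ?_).symm
        split_ifs with hk
        · rw [constantCoeff_eq_zero_of_ne (hD l k) (by rw [hk, sub_ne_zero]; exact Ne.symm hl),
            zero_mul]
        · rw [mul_zero]
    obtain ⟨w, hw, hpw⟩ := mem_xImage_freeGrading (p := (fun k => C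
        ((D.map constantCoeff).mulVecLin y k)) - D.mulVecLin fun k => C (y' k))
      ((freeGrading n K s j).sub_mem (C_comp_mem_freeGrading hx)
        (map_mem_of_mem_freeGrading (smulStable_freeGrading s) hD.single_mem
          (C_comp_mem_freeGrading hy'))) (by
        intro k
        rw [Pi.sub_apply, map_sub, constantCoeff_mulVec, hyy]
        simp)
    refine ⟨fun l => g (w l), fun l => ⟨_, hw l, rfl⟩, ?_⟩
    have := congrArg g hpw
    rw [map_sub, hex.apply_apply_eq_zero, sub_zero, map_sum] at this
    simpa only [map_smul] using this

theorem torVanishes_imageGrading_zero_iff (hD : HomogeneousMatrix s s' D)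
    (hex : Function.Exact D.mulVecLin g) {j : ℤ} :
    TorVanishes n K (imageGrading s g) 0 j ↔ ∀ x : Fin N → K, (∀ k, s k ≠ j → x k = 0) →
      x ∈ LinearMap.range (D.map constantCoeff).mulVecLin := by
  rw [torVanishes_zero_iff]
  constructor
  · intro h x hx
    exact (map_C_mem_xImage_iff hD hex hx).1 (h ⟨_, C_comp_mem_freeGrading hx, rfl⟩)
  · intro h y hy
    obtain ⟨x, hx, hxy⟩ := exists_sub_mem_xImage hy
    have := AddSubgroup.add_mem _ hxy ((map_C_mem_xImage_iff hD hex hx).2 (h x hx))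
    rwa [sub_add_cancel] at this

theorem torVanishes_imageGrading_one_iff_residue (hD : HomogeneousMatrix s s' D)
    (hD' : HomogeneousMatrix s' s'' D') (hex : Function.Exact D.mulVecLin g)
    (hex' : Function.Exact D'.mulVecLin D.mulVecLin) {j : ℤ} :
    TorVanishes n K (imageGrading s g) 1 j ↔ ∀ x : Fin N' → K, (∀ k, s' k ≠ j → x k = 0) →
      (D.map constantCoeff).mulVecLin x = 0 →
      x ∈ LinearMap.range (D'.map constantCoeff).mulVecLin := by
  rw [torVanishes_imageGrading_one_iff hD hex]
  have hmem : ∀ {y}, y ∈ imageGrading s' D.mulVecLin j → y ∈ freeGrading n K s j := by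
    rintro _ ⟨p, hp, rfl⟩
    exact map_mem_of_mem_freeGrading (smulStable_freeGrading s) hD.single_mem hp
  constructor
  · intro h x hx hx0
    have h1 : D.mulVecLin (fun k => (C (x k) : MvPolynomial (Fin n) K)) ∈
        imageGrading s' D.mulVecLin j := ⟨_, C_comp_mem_freeGrading hx, rfl⟩
    refine (map_C_mem_xImage_iff hD' hex' hx).1 (h _ h1 (mem_xImage_freeGrading (hmem h1) ?_))
    intro k
    rw [constantCoeff_mulVec]
    simpa using congrFun hx0 k
  · intro h y hy hyx
    obtain ⟨x, hx, hxy⟩ := exists_sub_mem_xImage hy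
    have h2 : y - D.mulVecLin (fun k => C (x k)) ∈ xImage n K (freeGrading n K s) j := by
      obtain ⟨w, hw, hyw⟩ := hxy
      refine ⟨w, fun k => ?_, hyw⟩
      obtain ⟨p, hp, hpw⟩ := hw k
      rw [← hpw]
      exact map_mem_of_mem_freeGrading (smulStable_freeGrading s) hD.single_mem hp
    have h3 : (D.map constantCoeff).mulVecLin x = 0 := by
      funext k
      have e1 := constantCoeff_eq_zero_of_mem_xImage hyx k
      have e2 := constantCoeff_eq_zero_of_mem_xImage h2 k
      rw [Pi.sub_apply, map_sub, e1, zero_sub, neg_eq_zero, constantCoeff_mulVec] at e2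
      simpa using e2
    have := AddSubgroup.add_mem _ hxy ((map_C_mem_xImage_iff hD' hex' hx).2 (h x hx h3))
    rwa [sub_add_cancel] at this

theorem GradedFreeResolution.betti_eq_zero_iff (F : GradedFreeResolution n K 𝒜) (i : ℕ) (j : ℤ) :
    F.betti i j = 0 ↔ ∀ x ∈ F.residueCycles i, x ∈ F.residueDegree i j →
      x ∈ LinearMap.range (F.residueDiff i) := by
  rw [GradedFreeResolution.betti, Module.finrank_eq_zero_iff_of_free,
    Submodule.Quotient.subsingleton_iff, Submodule.comap_subtype_eq_top]
  exact ⟨fun h x h1 h2 => h ⟨h1, h2⟩, fun h x hx => h x hx.1 hx.2⟩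

/-- `Tor` may be computed from any graded free resolution. -/
theorem GradedFreeResolution.torVanishes_iff (h𝒜 : SMulStable n K 𝒜) (hind : Independent 𝒜)
    (F : GradedFreeResolution n K 𝒜) (i : ℕ) (j : ℤ) :
    TorVanishes n K 𝒜 i j ↔ F.betti i j = 0 := by
  have hD : ∀ i, HomogeneousMatrix (F.shift i) (F.shift (i + 1)) (F.d i) := F.d_homogeneous
  have h0 : imageGrading (F.shift 0) F.aug = 𝒜 :=
    imageGrading_eq h𝒜 hind F.aug_homogeneous F.aug_surjective
  -- Iterated dimension shifting reduces all indices at least two to `Tor_1` of the image of a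
  -- differential.
  have hshift : ∀ m i, TorVanishes n K 𝒜 (m + i + 2) j ↔
      TorVanishes n K (imageGrading (F.shift (m + 1)) (F.d m).mulVecLin) (i + 1) j := by
    intro m
    induction m with
    | zero =>
      intro i
      rw [zero_add, ← torVanishes_imageGrading_succ_iff (hD 0) F.exact_zero, h0]
    | succ m ih =>
      intro i
      rw [← torVanishes_imageGrading_succ_iff (hD (m + 1)) (F.exact_succ m), ← ih (i + 1)]
      rw [show m + 1 + i + 2 = m + (i + 1) + 2 by omega]
  rw [F.betti_eq_zero_iff]
  rcases i with _ | _ | i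
  · have := torVanishes_imageGrading_zero_iff (hD 0) F.exact_zero (j := j)
    rw [h0] at this
    rw [this]
    exact ⟨fun h x _ hx => h x hx, fun h x hx => h x trivial hx⟩
  · have := torVanishes_imageGrading_one_iff_residue (hD 0) (hD 1) F.exact_zero (F.exact_succ 0)
      (j := j)
    rw [h0] at this
    rw [this]
    exact ⟨fun h x h1 hx => h x hx h1, fun h x hx h1 => h x h1 hx⟩
  · rw [show i + 1 + 1 = i + 0 + 2 from rfl, hshift i 0, torVanishes_imageGrading_one_iff_residue (hD (i + 1)) (hD (i + 2))
      (F.exact_succ i) (F.exact_succ (i + 1))]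
    exact ⟨fun h x h1 hx => h x hx h1, fun h x hx h1 => h x h1 hx⟩

end Comparison

/-! ### Existence of graded free resolutions. -/

section Existence

variable {n : ℕ} {K : Type*} [Field K] {A : Type*} [AddCommGroup A]
  [Module (MvPolynomial (Fin n) K) A] {𝒜 : ℤ → AddSubgroup A}

theorem GradedPieces.proj_map (G : GradedPieces 𝒜) (h𝒜 : SMulStable n K 𝒜) {N : ℕ}
    {s : Fin N → ℤ} {g : (Fin N → MvPolynomial (Fin n) K) →ₗ[MvPolynomial (Fin n) K] A}
    (hg : ∀ k, g (Pi.single k 1) ∈ 𝒜 (s k)) (j : ℤ) (p : Fin N → MvPolynomial (Fin n) K) :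
    G.proj j (g p) = g (((polyPieces n K).pi s).proj j p) := by
  obtain ⟨t, hjt, ht⟩ := ((polyPieces n K).pi s).exists_sum_mem p j
  conv_lhs => rw [← ht]
  rw [map_sum, map_sum, Finset.sum_eq_single j]
  · exact G.proj_of_mem (map_mem_of_mem_freeGrading h𝒜 hg (((polyPieces n K).pi s).proj_mem j p))
  · intro i _ hij
    exact G.proj_of_ne
      (map_mem_of_mem_freeGrading h𝒜 hg (((polyPieces n K).pi s).proj_mem i p)) hij
  · exact fun h => absurd hjt h

theorem GradedPieces.proj_mem_ker (G : GradedPieces 𝒜) (h𝒜 : SMulStable n K 𝒜) {N : ℕ}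
    {s : Fin N → ℤ} {g : (Fin N → MvPolynomial (Fin n) K) →ₗ[MvPolynomial (Fin n) K] A}
    (hg : ∀ k, g (Pi.single k 1) ∈ 𝒜 (s k)) (j : ℤ) {p : Fin N → MvPolynomial (Fin n) K}
    (hp : p ∈ LinearMap.ker g) : ((polyPieces n K).pi s).proj j p ∈ LinearMap.ker g := by
  rw [LinearMap.mem_ker] at hp ⊢
  rw [← G.proj_map h𝒜 hg, hp, map_zero]

variable (n K) in
/-- A homogeneous submodule of a graded free module. -/
structure HomogeneousSubmoduleOfFree where
  rank : ℕ
  shift : Fin rank → ℤ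
  carrier : Submodule (MvPolynomial (Fin n) K) (Fin rank → MvPolynomial (Fin n) K)
  proj_mem : ∀ j, ∀ p ∈ carrier, ((polyPieces n K).pi shift).proj j p ∈ carrier

theorem HomogeneousSubmoduleOfFree.exists_presentation (R : HomogeneousSubmoduleOfFree n K) :
    ∃ (R' : HomogeneousSubmoduleOfFree n K)
      (D : Matrix (Fin R.rank) (Fin R'.rank) (MvPolynomial (Fin n) K)),
      HomogeneousMatrix R.shift R'.shift D ∧ LinearMap.range D.mulVecLin = R.carrier ∧
        LinearMap.ker D.mulVecLin = R'.carrier := by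
  obtain ⟨N, g, e, hg, hspan⟩ := ((polyPieces n K).pi R.shift).exists_homogeneous_generators
    (IsNoetherian.noetherian R.carrier) R.proj_mem
  let D : Matrix (Fin R.rank) (Fin N) (MvPolynomial (Fin n) K) := Matrix.of fun l k => g k l
  have hD : HomogeneousMatrix R.shift e D := fun l k => hg k l
  refine ⟨⟨N, e, LinearMap.ker D.mulVecLin, fun j p hp => ?_⟩, D, hD, ?_, rfl⟩
  · exact ((polyPieces n K).pi R.shift).proj_mem_ker (smulStable_freeGrading _) hD.single_mem j hp
  · rw [Matrix.range_mulVecLin, ← hspan]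
    rfl

theorem exists_gradedFreeResolution [Module.Finite (MvPolynomial (Fin n) K) A]
    (G : GradedPieces 𝒜) (h𝒜 : SMulStable n K 𝒜) : Nonempty (GradedFreeResolution n K 𝒜) := by
  obtain ⟨N, g, e, hg, hspan⟩ := G.exists_homogeneous_generators
    (Module.Finite.fg_top (R := MvPolynomial (Fin n) K) (M := A)) (fun _ _ _ => trivial)
  let aug := Fintype.linearCombination (MvPolynomial (Fin n) K) g
  have haug : ∀ k, aug (Pi.single k 1) ∈ 𝒜 (e k) := by
    intro k
    simpa [aug] using hg k
  let R : HomogeneousSubmoduleOfFree n K :=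
    ⟨N, e, LinearMap.ker aug, fun j p hp => G.proj_mem_ker h𝒜 haug j hp⟩
  -- A presentation is chosen for every homogeneous submodule of a free module at once, so that the
  -- resolution is obtained by iterating `next`.
  choose next D hD hrange hker using
    HomogeneousSubmoduleOfFree.exists_presentation (n := n) (K := K)
  let syz : ℕ → HomogeneousSubmoduleOfFree n K := fun i => Nat.rec R (fun _ Q => next Q) i
  exact ⟨{
    rank := fun i => (syz i).rank
    shift := fun i => (syz i).shift
    d := fun i => D (syz i)
    aug := aug
    d_homogeneous := fun i => hD (syz i)
    aug_homogeneous := haug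
    aug_surjective := by
      rw [← LinearMap.range_eq_top, Fintype.range_linearCombination, hspan]
    exact_zero := LinearMap.exact_iff.2 (hrange R).symm
    exact_succ := fun i => LinearMap.exact_iff.2
      ((hker (syz i)).trans (hrange (syz (i + 1))).symm) }⟩

end Existence

/-! ### Koszul cycles, boundaries and homology; the case where all forms of degree `c` lie in `(u)`.
-/

section Pieces

variable {n : ℕ} {K : Type*} [Field K] {A : Type*} [AddCommGroup A]
  [Module (MvPolynomial (Fin n) K) A] {r : ℕ}

/-- Homogeneous Koszul cycles. -/
noncomputable abbrev cyclePieces (u : Fin r → MvPolynomial (Fin n) K) (d : Fin r → ℕ) (𝒜 : ℤ → AddSubgroup A)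
    (t : ℕ) (j : ℤ) : AddSubgroup (Chain r t A) :=
  chainGrading d 𝒜 t j ⊓ (cycles u A t).toAddSubgroup

/-- Boundaries of homogeneous Koszul chains. -/
noncomputable abbrev boundaryPieces (u : Fin r → MvPolynomial (Fin n) K) (d : Fin r → ℕ)
    (𝒜 : ℤ → AddSubgroup A) (t : ℕ) (j : ℤ) : AddSubgroup (Chain r t A) :=
  (chainGrading d 𝒜 (t + 1) j).map (diff u A t).toAddMonoidHom

/-- Classes of homogeneous Koszul cycles modulo boundaries. -/
noncomputable abbrev homologyPieces (u : Fin r → MvPolynomial (Fin n) K) (d : Fin r → ℕ)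
    (𝒜 : ℤ → AddSubgroup A) (t : ℕ) (j : ℤ) : AddSubgroup (Chain r t A ⧸ boundaries u A t) :=
  (cyclePieces u d 𝒜 t j).map (boundaries u A t).mkQ.toAddMonoidHom

variable {𝒜 : ℤ → AddSubgroup A} {u : Fin r → MvPolynomial (Fin n) K} {d : Fin r → ℕ}

theorem smulStable_cyclePieces (h𝒜 : SMulStable n K 𝒜) (t : ℕ) :
    SMulStable n K (cyclePieces u d 𝒜 t) :=
  fun i j f m hf hm => ⟨h𝒜.pi _ i j f m hf hm.1, (cycles u A t).smul_mem f hm.2⟩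

theorem XStable.map {B : Type*} [AddCommGroup B] [Module (MvPolynomial (Fin n) K) B]
    {ℬ : ℤ → AddSubgroup B} (hℬ : XStable n K ℬ)
    {C : Type*} [AddCommGroup C] [Module (MvPolynomial (Fin n) K) C]
    (g : B →ₗ[MvPolynomial (Fin n) K] C) :
    XStable n K (fun j => (ℬ j).map g.toAddMonoidHom) := by
  rintro k j _ ⟨b, hb, rfl⟩
  exact ⟨X k • b, hℬ k j b hb, map_smul g _ _⟩

theorem diff_mem_of_homogeneous (h𝒜 : SMulStable n K 𝒜) (hu : ∀ k, (u k).IsHomogeneous (d k))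
    {t : ℕ} {j : ℤ} {z : Chain r (t + 1) A} (hz : z ∈ chainGrading d 𝒜 (t + 1) j) :
    diff u A t z ∈ chainGrading d 𝒜 t j := by
  refine diff_mem_chainGrading (fun k j m hm => ?_) hz
  rw [add_comm]
  exact h𝒜 _ _ _ _ (hu k) hm

/-- The pieces of cycles live in the chain module itself, so the left map is the identity; exactness
is only required on pieces. -/
theorem pieceExact_chain (t : ℕ) :
    PieceExact n K (cyclePieces u d 𝒜 (t + 1)) (chainGrading d 𝒜 (t + 1))
      (boundaryPieces u d 𝒜 t) LinearMap.id (diff u A t) where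
  f_mem ha := ha.1
  f_inj _ h := h
  g_mem hb := ⟨_, hb, rfl⟩
  g_f ha := ha.2
  exact hb hb0 := ⟨_, ⟨hb, hb0⟩, rfl⟩
  surj := by
    rintro j _ ⟨b, hb, rfl⟩
    exact ⟨b, hb, rfl⟩

theorem pieceExact_homology (G : GradedPieces 𝒜) (h𝒜 : SMulStable n K 𝒜)
    (hu : ∀ k, (u k).IsHomogeneous (d k)) (t : ℕ) :
    PieceExact n K (boundaryPieces u d 𝒜 t) (cyclePieces u d 𝒜 t) (homologyPieces u d 𝒜 t)
      LinearMap.id (boundaries u A t).mkQ where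
  f_mem := by
    rintro j _ ⟨b, hb, rfl⟩
    exact ⟨diff_mem_of_homogeneous h𝒜 hu hb, diff_mem_cycles u t b⟩
  f_inj _ h := h
  g_mem hb := ⟨_, hb, rfl⟩
  g_f := by
    rintro j _ ⟨b, hb, rfl⟩
    exact (Submodule.Quotient.mk_eq_zero _).2 ⟨b, rfl⟩
  exact := by
    intro j b hb hb0
    obtain ⟨w, hw, hwb⟩ := exists_homogeneous_of_mem_boundaries G h𝒜 hu hb.1
      ((Submodule.Quotient.mk_eq_zero _).1 hb0)
    exact ⟨b, ⟨w, hw, hwb⟩, rfl⟩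
  surj := by
    rintro j _ ⟨b, hb, rfl⟩
    exact ⟨b, hb, rfl⟩

/-- The chains are a direct sum of copies of the module shifted by sums of `t` degrees, each sum at
most `t * c`. -/
theorem regLE_chainGrading {a : ℤ} {c : ℕ} (h : RegLE n K 𝒜 a) (hd : ∀ k, d k ≤ c) (t : ℕ) :
    RegLE n K (chainGrading d 𝒜 t) (t * c + a) := by
  intro i j hj
  refine torVanishes_piGrading fun J => h i _ ?_
  have h1 : ∑ k ∈ J.1, (d k : ℤ) ≤ J.1.card • (c : ℤ) :=
    Finset.sum_le_card_nsmul _ _ _ fun k _ => by exact_mod_cast hd k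
  rw [J.2, nsmul_eq_mul] at h1
  omega

theorem xStable_chainGrading (h𝒜 : SMulStable n K 𝒜) (t : ℕ) :
    XStable n K (chainGrading d 𝒜 t) := (h𝒜.pi _).xStable

theorem xStable_boundaryPieces (h𝒜 : SMulStable n K 𝒜) (t : ℕ) :
    XStable n K (boundaryPieces u d 𝒜 t) := (xStable_chainGrading h𝒜 (t + 1)).map _

theorem cyclePieces_zero (j : ℤ) : cyclePieces u d 𝒜 0 j = chainGrading d 𝒜 0 j :=
  inf_eq_left.2 fun _ _ => trivial

theorem socleLE_cyclePieces (h𝒜 : SMulStable n K 𝒜) {b : ℤ} {t : ℕ}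
    (h : SocleLE n K (chainGrading d 𝒜 t) b) : SocleLE n K (cyclePieces u d 𝒜 t) b := by
  cases t with
  | zero => rwa [show cyclePieces u d 𝒜 0 = chainGrading d 𝒜 0 from funext cyclePieces_zero]
  | succ t =>
    exact (pieceExact_chain t).socleLE_left (smulStable_cyclePieces h𝒜 _).xStable
      (xStable_chainGrading h𝒜 _) h

/-- Above degree `b` every element is a combination of elements one degree lower with the variables
as coefficients. Peeling off `m` variables leaves forms of degree `m` times elements of degree `b'`.
-/
theorem mem_of_generated {𝒩 : ℤ → AddSubgroup A} {b : ℤ} (h : ∀ j, b < j → 𝒩 j ≤ xImage n K 𝒩 j)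
    (Q : AddSubgroup A) (m : ℕ) : ∀ b' : ℤ, b ≤ b' →
      (∀ f : MvPolynomial (Fin n) K, f.IsHomogeneous m → ∀ y ∈ 𝒩 b', f • y ∈ Q) →
      𝒩 (b' + m) ≤ Q := by
  induction m with
  | zero =>
    intro b' _ hf z hz
    have := hf 1 (isHomogeneous_one _ _) z (by simpa using hz)
    rwa [one_smul] at this
  | succ m ih =>
    intro b' hb hf
    rw [Nat.cast_succ, add_comm (m : ℤ) 1, ← add_assoc]
    refine ih (b' + 1) (by omega) fun f hfm y hy => ?_
    obtain ⟨w, hw, rfl⟩ := h (b' + 1) (by omega) hy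
    rw [Finset.smul_sum]
    refine Q.sum_mem fun k _ => ?_
    rw [smul_smul]
    refine hf _ (hfm.mul (isHomogeneous_X K k)) _ ?_
    have := hw k
    rwa [add_sub_cancel_right] at this

/-- If the forms of degree `c` belong to `(u)`, Koszul homology vanishes in degrees at least
`b + c`, where `b` bounds the degrees of generators of the cycles. -/
theorem homologyPieces_eq_bot {c : ℕ}
    (hI : ∀ p : MvPolynomial (Fin n) K, p.IsHomogeneous c → p ∈ Ideal.span (Set.range u)) {t : ℕ}
    {b : ℤ} (h : RegLE n K (cyclePieces u d 𝒜 t) b) (j : ℤ) (hj : b + c - 1 < j) :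
    homologyPieces u d 𝒜 t j = ⊥ := by
  rw [AddSubgroup.eq_bot_iff_forall]
  rintro _ ⟨z, hz, rfl⟩
  refine (Submodule.Quotient.mk_eq_zero _).2 ?_
  -- As `j - c ≥ b`, a cycle of degree `j` is a sum of forms of degree `c` times cycles; these forms
  -- lie in `(u)` and therefore annihilate homology.
  have h1 := mem_of_generated (𝒩 := cyclePieces u d 𝒜 t) (b := b)
    (fun j hj => torVanishes_zero_iff.1 (h 0 j (by simpa using hj)))
    (boundaries u A t).toAddSubgroup c (j - c) (by omega)
    (fun f hf y hy => smul_mem_boundaries (hI f hf) hy.2)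
  rw [sub_add_cancel] at h1
  exact h1 hz

/-- With `b` the bound for `Z_t`: `H_t` is bounded by `b + c - 1`, hence `B_t` by `b + c` and
`Z_{t+1}` by `b + c + 1`. -/
theorem regLE_cyclePieces_of_forms_mem (G : GradedPieces 𝒜) (h𝒜 : SMulStable n K 𝒜)
    (hu : ∀ k, (u k).IsHomogeneous (d k)) {c : ℕ} (hd : ∀ k, d k ≤ c)
    (hI : ∀ p : MvPolynomial (Fin n) K, p.IsHomogeneous c → p ∈ Ideal.span (Set.range u))
    {a : ℤ} (h : RegLE n K 𝒜 a) (t : ℕ) :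
    RegLE n K (cyclePieces u d 𝒜 t) (t * (c + 1) + a) := by
  induction t with
  | zero =>
    rw [show cyclePieces u d 𝒜 0 = chainGrading d 𝒜 0 from funext cyclePieces_zero]
    simpa using regLE_chainGrading (c := c) h hd 0
  | succ t ih =>
    have hH := regLE_of_piece_eq_bot (n := n) (K := K) (homologyPieces_eq_bot hI ih)
    have hB := (pieceExact_homology G h𝒜 hu t).regLE_left (xStable_boundaryPieces h𝒜 t)
      (smulStable_cyclePieces h𝒜 t).xStable (ih.mono (b := t * (c + 1) + a + c) (by omega)) hH
    refine (pieceExact_chain t).regLE_left (smulStable_cyclePieces h𝒜 _).xStable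
      (xStable_chainGrading h𝒜 _) ((regLE_chainGrading h hd (t + 1)).mono ?_) (hB.mono ?_)
    · push_cast
      nlinarith
    · push_cast
      linarith

/-- Some power of every variable belongs to `(u) + ann A`. -/
def XNilpotent (u : Fin r → MvPolynomial (Fin n) K) (A : Type*) [AddCommGroup A]
    [Module (MvPolynomial (Fin n) K) A] : Prop :=
  ∀ i : Fin n, ∃ N : ℕ, (X i : MvPolynomial (Fin n) K) ^ N ∈
    Ideal.span (Set.range u) ⊔ Module.annihilator (MvPolynomial (Fin n) K) A

theorem XNilpotent.mono {r' : ℕ} {u : Fin r → MvPolynomial (Fin n) K}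
    {u' : Fin r' → MvPolynomial (Fin n) K} (h : XNilpotent u A)
    (huu : Set.range u ⊆ Set.range u') : XNilpotent u' A := by
  intro i
  obtain ⟨N, hN⟩ := h i
  exact ⟨N, sup_le_sup_right (Ideal.span_mono huu) _ hN⟩

/-- Pigeonhole on exponents: a monomial of degree above `∑ N_i` has some exponent above `N_i`. -/
theorem mem_span_X_pow {N : Fin n → ℕ} {p : MvPolynomial (Fin n) K} {z : ℤ}
    (hp : IsHomogeneousInt p z) (hz : ∑ i, (N i : ℤ) < z) :
    p ∈ Ideal.span (Set.range fun i => (X i : MvPolynomial (Fin n) K) ^ N i) := by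
  have h1 : (Set.range fun i => (X i : MvPolynomial (Fin n) K) ^ N i) =
      (fun s => monomial s 1) '' Set.range fun i => Finsupp.single i (N i) := by
    rw [← Set.range_comp]
    congr 1
    funext i
    exact X_pow_eq_monomial
  rw [h1, mem_ideal_span_monomial_image]
  intro m hm
  by_contra! hcon
  have h2 : ∀ i, m i ≤ N i := by
    intro i
    by_contra! hi
    exact hcon _ ⟨i, rfl⟩ (Finsupp.single_le_iff.2 hi.le)
  have h3 := hp m hm
  rw [Finsupp.degree_eq_sum] at h3
  push_cast at h3
  have h4 : ∑ i, (m i : ℤ) ≤ ∑ i, (N i : ℤ) :=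
    Finset.sum_le_sum fun i _ => by exact_mod_cast h2 i
  omega

/-- The cycles have finitely many homogeneous generators. In large degrees all coefficients lie in
the ideal of the `X_i ^ N_i`, which annihilates Koszul homology. -/
theorem exists_cyclePieces_le_boundaries (G : GradedPieces 𝒜) (h𝒜 : SMulStable n K 𝒜)
    [Module.Finite (MvPolynomial (Fin n) K) A]
    (hu : ∀ k, (u k).IsHomogeneous (d k)) (hnil : XNilpotent u A) (t : ℕ) :
    ∃ σ : ℤ, ∀ j, σ < j → cyclePieces u d 𝒜 t j ≤ (boundaries u A t).toAddSubgroup := by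
  choose N hN using hnil
  have hfg : (cycles u A t).FG := IsNoetherian.noetherian _
  obtain ⟨m, g, e, hg, hspan⟩ := (G.chain d t).exists_homogeneous_generators hfg (by
    intro j z hz
    cases t with
    | zero => trivial
    | succ t =>
      refine mem_cycles_of_diff_eq_zero ?_
      rw [diff_proj G h𝒜 hu, diff_eq_zero_of_mem_cycles hz, map_zero])
  obtain ⟨E, hE⟩ : ∃ E : ℤ, ∀ k, e k ≤ E := by
    obtain ⟨E, hE⟩ := (Set.finite_range e).bddAbove
    exact ⟨E, fun k => hE ⟨k, rfl⟩⟩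
  refine ⟨E + ∑ i, (N i : ℤ), fun j hj z hz => ?_⟩
  obtain ⟨p, hp, rfl⟩ := (G.chain d t).exists_homogeneous_coeffs (h𝒜.pi _) hg hz.1
    (by rw [hspan]; exact hz.2)
  refine Submodule.sum_mem _ fun k _ => ?_
  have hgk : g k ∈ cycles u A t := by
    rw [← hspan]
    exact Submodule.subset_span ⟨k, rfl⟩
  have hpk := mem_span_X_pow (N := N) (hp k) (by have := hE k; omega)
  generalize p k = q at hpk
  induction hpk using Submodule.span_induction with
  | mem x hx =>
    obtain ⟨i, rfl⟩ := hx
    -- The part in `(u)` sends cycles to boundaries; the part in the annihilator kills the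
    -- coefficients.
    obtain ⟨b, hb, s, hs, hbs⟩ := Submodule.mem_sup.1 (hN i)
    change ((X i : MvPolynomial (Fin n) K) ^ N i) • g k ∈ boundaries u A t
    rw [← hbs, add_smul]
    have : s • g k = 0 := funext fun J => Module.mem_annihilator.1 hs _
    rw [this, add_zero]
    exact smul_mem_boundaries hb hgk
  | zero => rw [zero_smul]; exact Submodule.zero_mem _
  | add x y _ _ hx hy => rw [add_smul]; exact Submodule.add_mem _ hx hy
  | smul b x _ hx => rw [smul_eq_mul, mul_smul]; exact Submodule.smul_mem _ _ hx

end Pieces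

/-! ### Comparing cycles with and without the last generator. -/

section AddGenerator

variable {n : ℕ} {K : Type*} [Field K] {A : Type*} [AddCommGroup A]
  [Module (MvPolynomial (Fin n) K) A] {r : ℕ} {𝒜 : ℤ → AddSubgroup A}
  {u : Fin (r + 1) → MvPolynomial (Fin n) K} {d : Fin (r + 1) → ℕ}

/-- Homogeneous cycles `z` of the Koszul complex of `u_0, …, u_{r-1}` such that `u_r z` is a
boundary. -/
noncomputable abbrev liftablePieces (u : Fin (r + 1) → MvPolynomial (Fin n) K) (d : Fin (r + 1) → ℕ)
    (𝒜 : ℤ → AddSubgroup A) (t : ℕ) (j : ℤ) : AddSubgroup (Chain r t A) :=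
  cyclePieces (fun k => u k.castSucc) (fun k => d k.castSucc) 𝒜 t j ⊓
    ((boundaries (fun k => u k.castSucc) A t).comap
      (LinearMap.lsmul _ _ (u (Fin.last r)))).toAddSubgroup

/-- Multiplication by `u_r` from chains to chains modulo boundaries. -/
noncomputable abbrev lastSMul (u : Fin (r + 1) → MvPolynomial (Fin n) K) (A : Type*)
    [AddCommGroup A] [Module (MvPolynomial (Fin n) K) A] (t : ℕ) :
    Chain r t A →ₗ[MvPolynomial (Fin n) K] Chain r t A ⧸ boundaries (fun k => u k.castSucc) A t :=
  (boundaries (fun k => u k.castSucc) A t).mkQ.comp (LinearMap.lsmul _ _ (u (Fin.last r)))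

theorem xStable_liftablePieces (h𝒜 : SMulStable n K 𝒜) (t : ℕ) :
    XStable n K (liftablePieces u d 𝒜 t) :=
  fun k j _ hm => ⟨(smulStable_cyclePieces h𝒜 t).xStable k j _ hm.1,
    Submodule.smul_mem ((boundaries (fun k => u k.castSucc) A t).comap _) (X k) hm.2⟩

/-- The image of multiplication by `u_r` is indexed by the degree of the source, so no shift by the
degree of `u_r` appears. -/
theorem pieceExact_lastSMul (t : ℕ) :
    PieceExact n K (liftablePieces u d 𝒜 t)
      (cyclePieces (fun k => u k.castSucc) (fun k => d k.castSucc) 𝒜 t)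
      (fun j => (cyclePieces (fun k => u k.castSucc) (fun k => d k.castSucc) 𝒜 t j).map
        (lastSMul u A t).toAddMonoidHom) LinearMap.id (lastSMul u A t) where
  f_mem ha := ha.1
  f_inj _ h := h
  g_mem hb := ⟨_, hb, rfl⟩
  g_f ha := (Submodule.Quotient.mk_eq_zero _).2 ha.2
  exact {j b} hb hb0 := ⟨b, ⟨hb, (Submodule.Quotient.mk_eq_zero
    (boundaries (fun k => u k.castSucc) A t)).1 hb0⟩, rfl⟩
  surj := by
    rintro j _ ⟨b, hb, rfl⟩
    exact ⟨b, hb, rfl⟩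

theorem diff_eq_zero_iff {t : ℕ} (z : Chain (r + 1) (t + 1) A) :
    diff u A t z = 0 ↔ diff (fun k => u k.castSucc) A t
        (lowPart (MvPolynomial (Fin n) K) A r (t + 1) z) +
        ((-1) ^ t * u (Fin.last r)) • highPart (MvPolynomial (Fin n) K) A r t z = 0 ∧
      highPart (MvPolynomial (Fin n) K) A r t z ∈ cycles (fun k => u k.castSucc) A t := by
  rw [← lowPart_diff]
  cases t with
  | zero =>
    refine ⟨fun h => ⟨by rw [h, map_zero], trivial⟩, fun h => ?_⟩
    exact chain_zero_ext fun J => congrFun h.1 J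
  | succ t =>
    have h1 : highPart (MvPolynomial (Fin n) K) A r (t + 1) z ∈
        cycles (fun k => u k.castSucc) A (t + 1) ↔ highPart (MvPolynomial (Fin n) K) A r t (diff u A (t + 1) z) = 0 := by
      rw [highPart_diff]
      rfl
    rw [h1]
    refine ⟨fun h => ⟨by rw [h, map_zero], by rw [h, map_zero]⟩, fun h => ?_⟩
    exact chain_ext (fun J => congrFun h.1 J) (fun J => congrFun h.2 J)

theorem mem_chainGrading_succ_iff {t : ℕ} {j : ℤ} (z : Chain (r + 1) (t + 1) A) :
    z ∈ chainGrading d 𝒜 (t + 1) j ↔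
      lowPart (MvPolynomial (Fin n) K) A r (t + 1) z ∈
        chainGrading (fun k => d k.castSucc) 𝒜 (t + 1) j ∧
      highPart (MvPolynomial (Fin n) K) A r t z ∈
        chainGrading (fun k => d k.castSucc) 𝒜 t (j - d (Fin.last r)) := by
  have hlow : ∀ J : {J : Finset (Fin r) // J.card = t + 1}, ∑ k ∈ (low J).1, (d k : ℤ) =
      ∑ k ∈ J.1, (d k.castSucc : ℤ) := fun J => Finset.sum_map _ _ _
  have hhigh : ∀ J : {J : Finset (Fin r) // J.card = t}, ∑ k ∈ (high J).1, (d k : ℤ) =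
      d (Fin.last r) + ∑ k ∈ J.1, (d k.castSucc : ℤ) := fun J => by
    rw [high, Finset.sum_insert (last_notMem_map _), Finset.sum_map]
    rfl
  constructor
  · intro h
    refine ⟨fun J => ?_, fun J => ?_⟩
    · have := h (low J)
      simp only [hlow] at this
      exact this
    · have := h (high J)
      simp only [hhigh, ← sub_sub] at this
      exact this
  · rintro ⟨h1, h2⟩ J
    by_cases hJ : Fin.last r ∈ J.1
    · obtain ⟨J, rfl⟩ := exists_high J hJ
      simp only [hhigh, ← sub_sub]
      exact h2 J
    · obtain ⟨J, rfl⟩ := exists_low J hJ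
      simp only [hlow]
      exact h1 J

/-- The inclusion of the Koszul complex of `u_0, …, u_{r-1}` into that of `u_0, …, u_r`. -/
noncomputable def lowIncl (S : Type*) [CommRing S] (A : Type*) [AddCommGroup A] [Module S A]
    (r t : ℕ) : Chain r (t + 1) A →ₗ[S] Chain (r + 1) (t + 1) A where
  toFun y := glue y 0
  map_add' _ _ := chain_ext (fun J => by simp [glue_low]) (fun J => by simp [glue_high])
  map_smul' _ _ := chain_ext (fun J => by simp [glue_low]) (fun J => by simp [glue_high])

/-- A chain with low part `y` and high part `w` is a cycle iff `w` is a cycle and `∂y = ∓ u_r w`.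
Hence the possible high parts are exactly the cycles that `u_r` turns into boundaries. -/
theorem pieceExact_addGenerator (G : GradedPieces 𝒜) (h𝒜 : SMulStable n K 𝒜)
    (hu : ∀ k, (u k).IsHomogeneous (d k)) (t : ℕ) :
    PieceExact n K (cyclePieces (fun k => u k.castSucc) (fun k => d k.castSucc) 𝒜 (t + 1))
      (cyclePieces u d 𝒜 (t + 1)) (fun j => liftablePieces u d 𝒜 t (j - d (Fin.last r)))
      (lowIncl _ A r t) (highPart (MvPolynomial (Fin n) K) A r t) where
  f_mem := by
    intro j y hy
    refine ⟨(mem_chainGrading_succ_iff (n := n) (K := K) _).2 ?_, (diff_eq_zero_iff _).2 ?_⟩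
    · change lowPart (MvPolynomial (Fin n) K) A r (t + 1) (glue y 0) ∈ _ ∧ highPart (MvPolynomial (Fin n) K) A r t (glue y 0) ∈ _
      rw [lowPart_glue, highPart_glue]
      exact ⟨hy.1, AddSubgroup.zero_mem _⟩
    · change _ + _ • highPart (MvPolynomial (Fin n) K) A r t (glue y 0) = 0 ∧ highPart (MvPolynomial (Fin n) K) A r t (glue y 0) ∈ _
      rw [highPart_glue, smul_zero, add_zero]
      change diff _ A t (lowPart (MvPolynomial (Fin n) K) A r (t + 1) (glue y 0)) = 0 ∧ _
      rw [lowPart_glue]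
      exact ⟨hy.2, Submodule.zero_mem _⟩
  f_inj := by
    intro j y _ h
    have h1 := congrArg (lowPart (MvPolynomial (Fin n) K) A r (t + 1)) h
    change lowPart (MvPolynomial (Fin n) K) A r (t + 1) (glue y 0) = _ at h1
    rwa [lowPart_glue, map_zero] at h1
  g_mem := by
    intro j z hz
    obtain ⟨h1, h2⟩ := (diff_eq_zero_iff z).1 hz.2
    refine ⟨⟨((mem_chainGrading_succ_iff (n := n) (K := K) z).1 hz.1).2, h2⟩, ?_⟩
    change u (Fin.last r) • highPart (MvPolynomial (Fin n) K) A r t z ∈ boundaries _ A t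
    refine ⟨(-(-1) ^ t : MvPolynomial (Fin n) K) • lowPart (MvPolynomial (Fin n) K) A r (t + 1) z, ?_⟩
    rw [map_smul, eq_neg_of_add_eq_zero_left h1, smul_neg, neg_smul, neg_neg, smul_smul,
      ← mul_assoc, ← mul_pow]
    simp
  g_f := fun {j y} _ => highPart_glue y 0
  exact := by
    intro j z hz hz0
    obtain ⟨h1, h2⟩ := (diff_eq_zero_iff z).1 hz.2
    rw [hz0, smul_zero, add_zero] at h1
    refine ⟨lowPart (MvPolynomial (Fin n) K) A r (t + 1) z,
      ⟨((mem_chainGrading_succ_iff (n := n) (K := K) z).1 hz.1).1, h1⟩, ?_⟩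
    exact chain_ext (fun J => glue_low _ _ _)
      (fun J => (glue_high _ _ _).trans (congrFun hz0 J).symm)
  surj := by
    rintro j w ⟨⟨hw, hwc⟩, hwb⟩
    have hwj : u (Fin.last r) • w ∈ chainGrading (fun k => d k.castSucc) 𝒜 t j := by
      have := h𝒜.pi _ _ _ _ _ (hu (Fin.last r)) hw
      rwa [add_sub_cancel] at this
    obtain ⟨y, hy, hyw⟩ := exists_homogeneous_of_mem_boundaries G h𝒜
      (fun k => hu k.castSucc) hwj hwb
    have hy' : (-(-1) ^ t : MvPolynomial (Fin n) K) • y ∈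
        chainGrading (fun k => d k.castSucc) 𝒜 (t + 1) j := by
      rcases neg_one_pow_eq_or (MvPolynomial (Fin n) K) t with h | h <;> rw [h]
      · rw [neg_one_smul]
        exact AddSubgroup.neg_mem _ hy
      · rwa [neg_neg, one_smul]
    refine ⟨glue ((-(-1) ^ t : MvPolynomial (Fin n) K) • y) w,
      ⟨(mem_chainGrading_succ_iff (n := n) (K := K) _).2 ?_, (diff_eq_zero_iff _).2 ?_⟩,
      highPart_glue _ _⟩
    · rw [lowPart_glue, highPart_glue]
      exact ⟨hy', hw⟩
    · rw [lowPart_glue, highPart_glue]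
      refine ⟨?_, hwc⟩
      rw [map_smul, hyw, smul_smul, ← add_smul]
      simp

theorem RegLE.of_shift {ℬ : ℤ → AddSubgroup A} {c a : ℤ}
    (h : RegLE n K (fun j => ℬ (j - c)) a) : RegLE n K ℬ (a - c) := by
  intro i j hj z hz hzc
  obtain ⟨w, hw, hwz⟩ := h i (j + c) (by omega) z (by
    rw [mem_xGrading] at hz ⊢
    intro J
    rw [show j + c - i - c = j - i by ring]
    exact hz J) hzc
  refine ⟨w, ?_, hwz⟩
  rw [mem_xGrading] at hw ⊢
  intro J
  have := hw J
  rwa [show j + c - ((i + 1 : ℕ) : ℤ) - c = j - ((i + 1 : ℕ) : ℤ) by ring] at this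

/-- Removing a generator of degree `c` raises the regularity bound of Koszul cycles by one. -/
theorem regLE_cyclePieces_castSucc (G : GradedPieces 𝒜) (h𝒜 : SMulStable n K 𝒜)
    [Module.Finite (MvPolynomial (Fin n) K) A]
    (hu : ∀ k, (u k).IsHomogeneous (d k)) {c : ℕ} (hd : ∀ k, d k ≤ c) (hlast : d (Fin.last r) = c)
    (hnil : XNilpotent (fun k => u k.castSucc) A) {a : ℤ} (h : RegLE n K 𝒜 a) {m : ℕ}
    (hm : ∀ t : ℕ, RegLE n K (cyclePieces u d 𝒜 t) (t * (c + 1) + a + m)) (t : ℕ) :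
    RegLE n K (cyclePieces (fun k => u k.castSucc) (fun k => d k.castSucc) 𝒜 t)
      (t * (c + 1) + a + (m + 1)) := by
  -- Descending induction on `t`, starting beyond `r`, where there are no nonzero chains.
  obtain ⟨k, hk⟩ : ∃ k, r < t + k := ⟨r + 1, by omega⟩
  induction k generalizing t with
  | zero =>
    refine regLE_of_piece_eq_bot fun j _ => ?_
    rw [AddSubgroup.eq_bot_iff_forall]
    exact fun z _ => eq_zero_of_lt hk z
  | succ k ih =>
    have hZ : XStable n K (cyclePieces (fun k => u k.castSucc) (fun k => d k.castSucc) 𝒜 t) :=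
      (smulStable_cyclePieces h𝒜 t).xStable
    have h1 := ih (t + 1) (by omega)
    have hW : RegLE n K (liftablePieces u d 𝒜 t) (t * (c + 1) + a + (m + 1)) := by
      have h2 := (pieceExact_addGenerator G h𝒜 hu t).regLE_right
        (smulStable_cyclePieces h𝒜 _).xStable (smulStable_cyclePieces h𝒜 _).xStable
        (hm (t + 1)) (h1.mono (by linarith))
      -- Undoing the shift gives `(t + 1)(c + 1) - c = t(c + 1) + 1`; this is the one unit lost per
      -- removed generator.
      refine RegLE.mono h2.of_shift ?_
      rw [hlast]
      push_cast
      linarith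
    have E := pieceExact_lastSMul (u := u) (d := d) (𝒜 := 𝒜) t
    have hS : SocleLE n K (cyclePieces (fun k => u k.castSucc) (fun k => d k.castSucc) 𝒜 t)
        (t * (c + 1) + a + m) := by
      refine socleLE_cyclePieces h𝒜 (SocleLE.mono (regLE_chainGrading h
        (fun k => hd k.castSucc) t).socleLE ?_)
      nlinarith
    obtain ⟨σ, hσ⟩ := exists_cyclePieces_le_boundaries G h𝒜 (fun k => hu k.castSucc) hnil t
    -- The quotient vanishes in large degrees, so its socle bound bounds all of its degrees, and
    -- thereby its regularity.
    have hC := regLE_of_piece_eq_bot (n := n) (K := K) (SocleLE.piece_eq_bot (σ := σ) (hZ.map (lastSMul u A t))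
      (E.socleLE_right (xStable_liftablePieces h𝒜 t) hZ hS (hW.mono (by linarith))) (by
        intro j hj
        rw [AddSubgroup.eq_bot_iff_forall]
        rintro _ ⟨z, hz, rfl⟩
        exact (Submodule.Quotient.mk_eq_zero _).2
          (Submodule.smul_mem (boundaries _ A t) _ (hσ j hj hz))))
    exact E.regLE_middle (xStable_liftablePieces h𝒜 t) hZ hW (hC.mono (by linarith))

end AddGenerator

/-! ### The bounds for cycles and homology, by induction on the number of missing forms. -/

section Bounds

variable {n : ℕ} {K : Type*} [Field K] {A : Type*} [AddCommGroup A]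
  [Module (MvPolynomial (Fin n) K) A] {𝒜 : ℤ → AddSubgroup A}
  [Module.Finite (MvPolynomial (Fin n) K) A]

/-- Regularity of Koszul cycles, when `m` forms of degree `c` together with `(u)` generate all
forms of degree `c`. -/
theorem regLE_cyclePieces (G : GradedPieces 𝒜) (h𝒜 : SMulStable n K 𝒜) {c : ℕ} {a : ℤ}
    (h : RegLE n K 𝒜 a) (m : ℕ) : ∀ {r : ℕ} {u : Fin r → MvPolynomial (Fin n) K} {d : Fin r → ℕ},
    (∀ k, (u k).IsHomogeneous (d k)) → (∀ k, d k ≤ c) → XNilpotent u A →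
    ∀ f : Fin m → MvPolynomial (Fin n) K, (∀ l, (f l).IsHomogeneous c) →
    (∀ p : MvPolynomial (Fin n) K, p.IsHomogeneous c →
      p ∈ Ideal.span (Set.range u ∪ Set.range f)) →
    ∀ t : ℕ, RegLE n K (cyclePieces u d 𝒜 t) (t * (c + 1) + a + m) := by
  induction m with
  | zero =>
    intro r u d hu hd hnil f hf hI t
    have := regLE_cyclePieces_of_forms_mem G h𝒜 hu hd (fun p hp => by simpa using hI p hp) h t
    simpa using this
  | succ m ih =>
    intro r u d hu hd hnil f hf hI t
    -- One missing form becomes a generator. Minimality of the generators need not survive this, so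
    -- the induction keeps only their homogeneity, the degree bound and `XNilpotent`.
    let u' : Fin (r + 1) → MvPolynomial (Fin n) K := Fin.snoc u (f (Fin.last m))
    let d' : Fin (r + 1) → ℕ := Fin.snoc d c
    have hu1 : (fun k : Fin r => u' k.castSucc) = u := by funext k; simp [u']
    have hd1 : (fun k : Fin r => d' k.castSucc) = d := by funext k; simp [d']
    have hu' : ∀ k, (u' k).IsHomogeneous (d' k) := by
      intro k
      induction k using Fin.lastCases with
      | last => simpa [u', d'] using hf (Fin.last m)
      | cast k => simpa [u', d'] using hu k
    have hd' : ∀ k, d' k ≤ c := by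
      intro k
      induction k using Fin.lastCases with
      | last => simp [d']
      | cast k => simpa [d'] using hd k
    have hrange : Set.range u ⊆ Set.range u' := by
      rintro _ ⟨k, rfl⟩
      exact ⟨k.castSucc, by simp [u']⟩
    have h1 := ih hu' hd' (hnil.mono hrange) (fun l => f l.castSucc) (fun l => hf l.castSucc) (by
      intro p hp
      refine Ideal.span_mono ?_ (hI p hp)
      rintro _ (hx | ⟨l, rfl⟩)
      · exact Or.inl (hrange hx)
      · induction l using Fin.lastCases with
        | last => exact Or.inl ⟨Fin.last r, by simp [u']⟩
        | cast l => exact Or.inr ⟨l, rfl⟩)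
    have h2 := regLE_cyclePieces_castSucc G h𝒜 hu' hd' (by simp [d']) (by rwa [hu1]) h h1 t
    rw [hu1, hd1] at h2
    exact_mod_cast h2

/-- Regularity of Koszul homology, when `m` forms of degree `c` together with `(u)` generate all
forms of degree `c`. -/
theorem regLE_homologyPieces (G : GradedPieces 𝒜) (h𝒜 : SMulStable n K 𝒜) {c : ℕ} {a : ℤ}
    (h : RegLE n K 𝒜 a) {m r : ℕ} {u : Fin r → MvPolynomial (Fin n) K} {d : Fin r → ℕ}
    (hu : ∀ k, (u k).IsHomogeneous (d k)) (hd : ∀ k, d k ≤ c) (hnil : XNilpotent u A)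
    (f : Fin m → MvPolynomial (Fin n) K) (hf : ∀ l, (f l).IsHomogeneous c)
    (hI : ∀ p : MvPolynomial (Fin n) K, p.IsHomogeneous c →
      p ∈ Ideal.span (Set.range u ∪ Set.range f)) (t : ℕ) :
    RegLE n K (homologyPieces u d 𝒜 t) (t * (c + 1) + a + m + c - 1) := by
  have hZ := regLE_cyclePieces G h𝒜 h m hu hd hnil f hf hI
  -- The socle argument needs `t * c + a ≤ t * (c + 1) + a + m + c - 1`, which fails for `t = c = m
  -- = 0`; for `m = 0` homology is bounded directly.
  rcases Nat.eq_zero_or_pos m with rfl | hm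
  · refine regLE_of_piece_eq_bot (homologyPieces_eq_bot (fun p hp => ?_) (hZ t))
    simpa using hI p hp
  · have hB : RegLE n K (boundaryPieces u d 𝒜 t) (t * (c + 1) + a + m + c) := by
      refine (pieceExact_chain t).regLE_right (smulStable_cyclePieces h𝒜 _).xStable
        (xStable_chainGrading h𝒜 _) ((regLE_chainGrading h hd (t + 1)).mono ?_)
        ((hZ (t + 1)).mono ?_)
      · push_cast
        nlinarith
      · push_cast
        linarith
    obtain ⟨σ, hσ⟩ := exists_cyclePieces_le_boundaries G h𝒜 hu hnil t
    refine regLE_of_piece_eq_bot (SocleLE.piece_eq_bot (σ := σ)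
      ((smulStable_cyclePieces h𝒜 t).xStable.map _)
      ((pieceExact_homology G h𝒜 hu t).socleLE_right (xStable_boundaryPieces h𝒜 t)
        (smulStable_cyclePieces h𝒜 t).xStable
        (socleLE_cyclePieces h𝒜 ((regLE_chainGrading h hd t).socleLE.mono ?_))
        (hB.mono (by linarith))) ?_)
    · have : (1 : ℤ) ≤ m := by exact_mod_cast hm
      nlinarith
    · intro j hj
      rw [AddSubgroup.eq_bot_iff_forall]
      rintro _ ⟨z, hz, rfl⟩
      exact (Submodule.Quotient.mk_eq_zero _).2 (hσ j hj hz)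

end Bounds

/-! ### From dimension at most zero to nilpotency of the variables. -/

section Support

variable {n : ℕ} {K : Type*} [Field K] {A : Type*} [AddCommGroup A]
  [Module (MvPolynomial (Fin n) K) A] {𝒜 : ℤ → AddSubgroup A}

theorem homogeneousComponent_mem_annihilator (G : GradedPieces 𝒜) (h𝒜 : SMulStable n K 𝒜)
    {p : MvPolynomial (Fin n) K} (hp : p ∈ Module.annihilator (MvPolynomial (Fin n) K) A) (i : ℕ) :
    homogeneousComponent i p ∈ Module.annihilator (MvPolynomial (Fin n) K) A := by
  rw [Module.mem_annihilator] at hp ⊢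
  intro m
  obtain ⟨s, -, hs⟩ := G.exists_sum_mem m 0
  rw [← hs, Finset.smul_sum]
  refine Finset.sum_eq_zero fun j _ => ?_
  have h1 := G.proj_smul_of_mem h𝒜 p (G.proj_mem j m) (i + j)
  rw [hp, map_zero, add_sub_cancel_right] at h1
  exact h1.symm

attribute [local instance] MvPolynomial.gradedAlgebra

/-- Over the polynomial ring, a graded module `A/(u)A` of dimension at most zero is supported at
the irrelevant ideal. -/
theorem xNilpotent_of_supportDim_le_zero [Module.Finite (MvPolynomial (Fin n) K) A]
    (G : GradedPieces 𝒜) (h𝒜 : SMulStable n K 𝒜) {r : ℕ} {u : Fin r → MvPolynomial (Fin n) K}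
    {d : Fin r → ℕ} (hu : ∀ k, (u k).IsHomogeneous (d k))
    (hdim : Module.supportDim (MvPolynomial (Fin n) K)
      (A ⧸ (Ideal.span (Set.range u) • ⊤ : Submodule (MvPolynomial (Fin n) K) A)) ≤ 0) :
    XNilpotent u A := by
  intro i
  rw [← Ideal.mem_radical_iff, Ideal.radical_eq_sInf, Submodule.mem_sInf]
  rintro p ⟨hle, hp⟩
  let 𝒮 := homogeneousSubmodule (Fin n) K
  -- A prime over `(u) + ann A` need not be homogeneous. Its homogeneous core is prime, still
  -- contains both homogeneous ideals, and lies in the irrelevant ideal.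
  let q : Ideal (MvPolynomial (Fin n) K) := (Ideal.homogeneousCore 𝒮 p).toIdeal
  have hqp : q ≤ p := Ideal.toIdeal_homogeneousCore_le 𝒮 p
  have hq : q.IsPrime := hp.homogeneousCore
  have hmem : ∀ {f : MvPolynomial (Fin n) K} {e : ℕ}, f.IsHomogeneous e → f ∈ p → f ∈ q :=
    fun hf hfp => Ideal.mem_homogeneousCore_of_homogeneous_of_mem ⟨_, hf⟩ hfp
  have huq : Ideal.span (Set.range u) ≤ q := by
    rw [Ideal.span_le]
    rintro _ ⟨k, rfl⟩
    exact hmem (hu k) (hle (Ideal.mem_sup_left (Ideal.subset_span ⟨k, rfl⟩)))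
  have haq : Module.annihilator (MvPolynomial (Fin n) K) A ≤ q := by
    intro f hf
    rw [← sum_homogeneousComponent f]
    refine q.sum_mem fun e _ => hmem (homogeneousComponent_isHomogeneous e f) (hle ?_)
    exact Ideal.mem_sup_right (homogeneousComponent_mem_annihilator G h𝒜 hf e)
  let m : Ideal (MvPolynomial (Fin n) K) :=
    RingHom.ker (constantCoeff : MvPolynomial (Fin n) K →+* K)
  have hm : m.IsPrime := RingHom.ker_isPrime _
  have hqm : q ≤ m := by
    intro f hf
    have h1 := homogeneousComponent_mem_of_mem (Ideal.homogeneousCore 𝒮 p).isHomogeneous hf 0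
    rw [homogeneousComponent_zero] at h1
    by_contra hne
    refine hp.ne_top (Ideal.eq_top_of_isUnit_mem _ (hqp h1) ?_)
    exact (isUnit_iff_ne_zero.2 hne).map C
  have hsupp : ∀ {P : Ideal (MvPolynomial (Fin n) K)} (hP : P.IsPrime), q ≤ P →
      (⟨P, hP⟩ : PrimeSpectrum (MvPolynomial (Fin n) K)) ∈
        Module.support (MvPolynomial (Fin n) K)
          (A ⧸ (Ideal.span (Set.range u) • ⊤ : Submodule (MvPolynomial (Fin n) K) A)) := by
    intro P hP hqP
    rw [Module.support_quotient]
    exact ⟨Module.mem_support_iff_of_finite.2 (haq.trans hqP), huq.trans hqP⟩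
  -- The core and the irrelevant ideal both lie in the support, so dimension at most zero forces
  -- them to coincide.
  have hmax := Order.krullDim_nonpos_iff_forall_isMax.1 hdim ⟨_, hsupp hq le_rfl⟩
  have hmq : m ≤ q := hmax (b := ⟨_, hsupp hm hqm⟩) hqm
  refine hqp (hmq ?_)
  exact constantCoeff_X K i

end Support

/-! ### Degrees of minimal generators, and a complement of `I` in degree `c`. -/

section Generators

variable {n : ℕ} {K : Type*} [Field K] {r : ℕ} {I : Ideal (MvPolynomial (Fin n) K)}
  {u : Fin r → MvPolynomial (Fin n) K} {d : Fin r → ℕ}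

/-- A generator of degree above `c` cannot occur in expressions of forms of degree at most `c`. As
those forms generate `I`, it would be redundant. -/
theorem IsMinimalGenerators.degree_le (hu : IsMinimalGenerators I u d) {c : ℕ}
    (hc : GeneratedInDegreesLE I c) (k : Fin r) : d k ≤ c := by
  by_contra! hk
  have key : ∀ x ∈ I, ∃ b : Fin r → MvPolynomial (Fin n) K, b k = 0 ∧ ∑ l, b l * u l = x := by
    intro x hx
    rw [← hc] at hx
    induction hx using Submodule.span_induction with
    | mem f hf =>
      obtain ⟨hfI, i, hi, hfi⟩ := hf
      rw [← hu.span_eq] at hfI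
      obtain ⟨b, hb, hfb⟩ := (polyPieces n K).exists_homogeneous_coeffs smulStable_polyGrading
        (fun l => isHomogeneousInt_natCast.2 (hu.homogeneous l))
        (isHomogeneousInt_natCast.2 hfi) hfI
      exact ⟨b, (hb k).eq_zero_of_neg (by omega), hfb.symm⟩
    | zero => exact ⟨0, rfl, by simp⟩
    | add x y _ _ hx hy =>
      obtain ⟨b, hb, rfl⟩ := hx
      obtain ⟨b', hb', rfl⟩ := hy
      exact ⟨b + b', by simp [hb, hb'], by simp [add_mul, Finset.sum_add_distrib]⟩
    | smul a x _ hx =>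
      obtain ⟨b, hb, rfl⟩ := hx
      exact ⟨a • b, by simp [hb], by simp [Finset.mul_sum, mul_assoc]⟩
  have hkI : u k ∈ I := by
    rw [← hu.span_eq]
    exact Ideal.subset_span ⟨k, rfl⟩
  obtain ⟨b, hb, hbk⟩ := key _ hkI
  -- A relation whose `k`-th coefficient is `1`, which does not lie in `𝔪`.
  have h1 := hu.minimal (Pi.single k 1 - b) (by
    simp [sub_mul, Finset.sum_sub_distrib, hbk, Pi.single_apply]) k
  have h2 : Ideal.span (Set.range (X : Fin n → MvPolynomial (Fin n) K)) ≤
      RingHom.ker (constantCoeff : MvPolynomial (Fin n) K →+* K) := by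
    rw [Ideal.span_le]
    rintro _ ⟨i, rfl⟩
    exact constantCoeff_X K i
  have h3 := h2 h1
  rw [RingHom.mem_ker, Pi.sub_apply, hb, Pi.single_eq_same, sub_zero, map_one] at h3
  exact one_ne_zero h3

theorem exists_complement_forms (I : Ideal (MvPolynomial (Fin n) K)) (c : ℕ) :
    ∃ f : Fin (quotientDim I c) → MvPolynomial (Fin n) K, (∀ l, (f l).IsHomogeneous c) ∧
      ∀ p : MvPolynomial (Fin n) K, p.IsHomogeneous c → p ∈ I ⊔ Ideal.span (Set.range f) := by
  have : Module.Finite K ((homogeneousSubmodule (Fin n) K c).map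
      (Ideal.Quotient.mkₐ K I).toLinearMap) :=
    Module.Finite.iff_fg.2 ((homogeneousSubmodule_fg (Fin n) K c).map _)
  let b := Module.finBasis K ((homogeneousSubmodule (Fin n) K c).map
    (Ideal.Quotient.mkₐ K I).toLinearMap)
  choose f hf hfb using fun l => (b l).2
  refine ⟨f, hf, fun p hp => ?_⟩
  have h1 := congrArg Subtype.val
    (b.sum_repr ⟨Ideal.Quotient.mkₐ K I p, p, hp, rfl⟩)
  rw [AddSubmonoidClass.coe_finsetSum] at h1
  have h2 : Ideal.Quotient.mk I (∑ l, b.repr ⟨Ideal.Quotient.mkₐ K I p, p, hp, rfl⟩ l • f l) =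
      Ideal.Quotient.mk I p := by
    rw [map_sum]
    refine Eq.trans (Finset.sum_congr rfl fun l _ => ?_) h1
    rw [Submodule.coe_smul, ← hfb l]
    rfl
  rw [Ideal.Quotient.eq] at h2
  have h3 : ∑ l, b.repr ⟨Ideal.Quotient.mkₐ K I p, p, hp, rfl⟩ l • f l ∈
      Ideal.span (Set.range f) := by
    refine Submodule.sum_mem _ fun l _ => ?_
    rw [smul_eq_C_mul]
    exact Ideal.mul_mem_left _ _ (Ideal.subset_span ⟨l, rfl⟩)
  have h4 := Ideal.sub_mem (I ⊔ Ideal.span (Set.range f)) (Ideal.mem_sup_right h3)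
    (Ideal.mem_sup_left h2)
  rwa [sub_sub_cancel] at h4

end Generators

/-! ### Passing to the gradings and the extended-real regularity of the statement. -/

section Transfer

variable {n : ℕ} {K : Type*} [Field K] {A : Type*} [AddCommGroup A]
  [Module (MvPolynomial (Fin n) K) A] {𝒜 : ℤ → AddSubgroup A} {r : ℕ}
  {u : Fin r → MvPolynomial (Fin n) K} {d : Fin r → ℕ}

theorem smulStable_cyclesGrading (h𝒜 : SMulStable n K 𝒜) (t : ℕ) :
    SMulStable n K (cyclesGrading u d 𝒜 t) :=
  fun i j f m hf hm => h𝒜.pi _ i j f m.1 hf hm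

theorem independent_cyclesGrading (G : GradedPieces 𝒜) (t : ℕ) :
    Independent (cyclesGrading u d 𝒜 t) :=
  (G.chain d t).independent.of_injective (cycles u A t).subtype.toAddMonoidHom
    (fun ha => ha) (fun _ h => Subtype.ext h)

theorem regLE_cyclesGrading (h𝒜 : SMulStable n K 𝒜) {t : ℕ} {b : ℤ}
    (h : RegLE n K (cyclePieces u d 𝒜 t) b) : RegLE n K (cyclesGrading u d 𝒜 t) b :=
  fun i j hj => TorVanishes.of_bijective (ℬ := cyclePieces u d 𝒜 t) (g := (cycles u A t).subtype)
    (smulStable_cyclesGrading h𝒜 t).xStable (fun {_ a} ha => ⟨ha, a.2⟩)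
    (fun _ h => Subtype.ext h) (fun {_ b} hb => ⟨⟨b, hb.2⟩, hb.1, rfl⟩) (h i j hj)

theorem smulStable_homologyGrading (h𝒜 : SMulStable n K 𝒜) (t : ℕ) :
    SMulStable n K (homologyGrading u d 𝒜 t) := by
  rintro i j f _ hf ⟨z, hz, rfl⟩
  exact ⟨f • z, smulStable_cyclesGrading h𝒜 t i j f z hf hz, rfl⟩

/-- If a sum of homogeneous cycles is `∂w`, each of them is `∂` of the corresponding component of
`w`. -/
theorem independent_homologyPieces (G : GradedPieces 𝒜) (h𝒜 : SMulStable n K 𝒜)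
    (hu : ∀ k, (u k).IsHomogeneous (d k)) (t : ℕ) : Independent (homologyPieces u d 𝒜 t) := by
  intro s f hf h0 j hj
  choose! z hz hzf using hf
  have h1 : ∑ i ∈ s, z i ∈ boundaries u A t := by
    rw [← Submodule.Quotient.mk_eq_zero, ← Submodule.mkQ_apply, map_sum, ← h0]
    exact Finset.sum_congr rfl hzf
  obtain ⟨w, hw⟩ := h1
  have h2 := diff_proj (d := d) G h𝒜 hu t j w
  rw [hw, map_sum, Finset.sum_eq_single j, (G.chain d t).proj_of_mem (hz j hj).1] at h2
  · rw [← hzf j hj]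
    exact (Submodule.Quotient.mk_eq_zero _).2 ⟨_, h2⟩
  · exact fun i hi hij => (G.chain d t).proj_of_ne (hz i hi).1 hij
  · exact fun h => absurd hj h

/-- The Koszul homology module, embedded into the chains modulo boundaries. -/
noncomputable def homologyIncl (u : Fin r → MvPolynomial (Fin n) K) (A : Type*) [AddCommGroup A]
    [Module (MvPolynomial (Fin n) K) A] (t : ℕ) :
    Homology u A t →ₗ[MvPolynomial (Fin n) K] Chain r t A ⧸ boundaries u A t :=
  Submodule.mapQ _ _ (cycles u A t).subtype le_rfl

theorem homologyIncl_injective (t : ℕ) : Function.Injective (homologyIncl u A t) := by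
  rw [injective_iff_map_eq_zero]
  intro a ha
  obtain ⟨z, rfl⟩ := Submodule.Quotient.mk_surjective _ a
  exact (Submodule.Quotient.mk_eq_zero _).2 ((Submodule.Quotient.mk_eq_zero
    (boundaries u A t)).1 ha)

theorem homologyIncl_mem {t : ℕ} {j : ℤ} {a : Homology u A t}
    (ha : a ∈ homologyGrading u d 𝒜 t j) : homologyIncl u A t a ∈ homologyPieces u d 𝒜 t j := by
  obtain ⟨z, hz, rfl⟩ := ha
  exact ⟨z.1, ⟨hz, z.2⟩, rfl⟩

theorem independent_homologyGrading (G : GradedPieces 𝒜) (h𝒜 : SMulStable n K 𝒜)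
    (hu : ∀ k, (u k).IsHomogeneous (d k)) (t : ℕ) : Independent (homologyGrading u d 𝒜 t) :=
  (independent_homologyPieces G h𝒜 hu t).of_injective (homologyIncl u A t).toAddMonoidHom
    homologyIncl_mem (fun _ h => (map_eq_zero_iff _ (homologyIncl_injective t)).1 h)

theorem regLE_homologyGrading (h𝒜 : SMulStable n K 𝒜) {t : ℕ} {b : ℤ}
    (h : RegLE n K (homologyPieces u d 𝒜 t) b) : RegLE n K (homologyGrading u d 𝒜 t) b :=
  fun i j hj => TorVanishes.of_bijective (ℬ := homologyPieces u d 𝒜 t) (g := homologyIncl u A t)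
    (smulStable_homologyGrading h𝒜 t).xStable homologyIncl_mem
    (fun _ h => (map_eq_zero_iff _ (homologyIncl_injective t)).1 h) (by
      rintro j _ ⟨z, hz, rfl⟩
      exact ⟨_, ⟨⟨z, hz.2⟩, hz.1, rfl⟩, rfl⟩) (h i j hj)

/-- Each resolution in the supremum is treated separately, so none has to be constructed for cycles
or homology. -/
theorem reg_le_of_regLE (h𝒜 : SMulStable n K 𝒜) (hind : Independent 𝒜) {b : ℤ}
    (h : RegLE n K 𝒜 b) : reg n K 𝒜 ≤ ((b : ℝ) : EReal) := by
  refine iSup_le fun F => iSup_le fun i => iSup_le fun j => iSup_le fun hF => ?_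
  rw [EReal.coe_le_coe_iff, Int.cast_le]
  by_contra! hlt
  exact hF ((F.torVanishes_iff h𝒜 hind i j).1 (h i j hlt))

/-- Here a resolution must exist, since otherwise the supremum would be empty. The strict bound by
`b + 1` suits a supremum of integers. -/
theorem regLE_of_reg_le [Module.Finite (MvPolynomial (Fin n) K) A] (G : GradedPieces 𝒜)
    (h𝒜 : SMulStable n K 𝒜) {b : ℤ} (h : reg n K 𝒜 < (((b + 1 : ℤ) : ℝ) : EReal)) : RegLE n K 𝒜 b := by
  intro i j hj
  obtain ⟨F⟩ := exists_gradedFreeResolution G h𝒜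
  rw [F.torVanishes_iff h𝒜 G.independent]
  by_contra hF
  have h1 : (((j - i : ℤ) : ℝ) : EReal) < (((b + 1 : ℤ) : ℝ) : EReal) :=
    (le_iSup_of_le F (le_iSup_of_le i (le_iSup_of_le j
      (le_iSup (fun _ : F.betti i j ≠ 0 => (((j - i : ℤ) : ℝ) : EReal)) hF)))).trans_lt h
  rw [EReal.coe_lt_coe_iff, Int.cast_lt] at h1
  omega

theorem reg_le_add [Module.Finite (MvPolynomial (Fin n) K) A] (G : GradedPieces 𝒜)
    (h𝒜 : SMulStable n K 𝒜) {B : Type*} [AddCommGroup B] [Module (MvPolynomial (Fin n) K) B]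
    {ℬ : ℤ → AddSubgroup B} (hℬ : SMulStable n K ℬ) (hind : Independent ℬ) {x y : ℤ}
    (h : ∀ a, RegLE n K 𝒜 a → RegLE n K ℬ (x + a + y)) :
    reg n K ℬ ≤ ((x : ℝ) : EReal) + reg n K 𝒜 + ((y : ℝ) : EReal) := by
  have key : ∀ a : ℤ, reg n K 𝒜 < (((a + 1 : ℤ) : ℝ) : EReal) →
      reg n K ℬ ≤ (((x + a + y : ℤ) : ℝ) : EReal) := fun a ha =>
    reg_le_of_regLE hℬ hind (h a (regLE_of_reg_le G h𝒜 ha))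
  induction hreg : reg n K 𝒜 with
  | bot =>
    rw [EReal.add_bot, EReal.bot_add, le_bot_iff, EReal.eq_bot_iff_forall_lt]
    intro z
    -- For regularity `-∞` every integer is a bound for `𝒜`; this one places the bound for `ℬ` below
    -- the given real number.
    refine (key (⌊z⌋ - x - y - 1) (by rw [hreg]; exact EReal.bot_lt_coe _)).trans_lt ?_
    rw [EReal.coe_lt_coe_iff]
    have := Int.floor_le z
    push_cast
    linarith
  | coe z =>
    refine (key ⌊z⌋ ?_).trans ?_
    · rw [hreg, EReal.coe_lt_coe_iff, Int.cast_add, Int.cast_one]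
      exact Int.lt_floor_add_one z
    · rw [← EReal.coe_add, ← EReal.coe_add, EReal.coe_le_coe_iff]
      have := Int.floor_le z
      push_cast
      linarith
  | top => simp

end Transfer

end KoszulReg

open KoszulReg in
theorem theorem3p8 {K : Type*} [Field K] {n : ℕ}
    {M : Type*} [AddCommGroup M] [Module (MvPolynomial (Fin n) K) M]
    [Module.Finite (MvPolynomial (Fin n) K) M]
    (ℳ : ℤ → AddSubgroup M) (hM : IsGradedModule n K ℳ)
    (I : Ideal (MvPolynomial (Fin n) K))
    (hdim : Module.supportDim (MvPolynomial (Fin n) K)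
      (M ⧸ (I • ⊤ : Submodule (MvPolynomial (Fin n) K) M)) ≤ 0)
    (c : ℕ) (hc : GeneratedInDegreesLE I c)
    {r : ℕ} (u : Fin r → MvPolynomial (Fin n) K) (d : Fin r → ℕ)
    (hu : IsMinimalGenerators I u d) (t : ℕ) :
    reg n K (cyclesGrading u d ℳ t) ≤
        (((t * (c + 1) : ℤ) : ℝ) : EReal) + reg n K ℳ + (((quotientDim I c : ℤ) : ℝ) : EReal) ∧
      reg n K (homologyGrading u d ℳ t) ≤
        (((t * (c + 1) : ℤ) : ℝ) : EReal) + reg n K ℳ +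
          (((quotientDim I c + c - 1 : ℤ) : ℝ) : EReal) := by
  have hS : SMulStable n K ℳ := hM.smul_mem
  let G := GradedPieces.ofIsInternal hM.isInternal
  have hd := hu.degree_le hc
  have hnil : XNilpotent u M := xNilpotent_of_supportDim_le_zero G hS hu.homogeneous (by
    rwa [hu.span_eq])
  obtain ⟨f, hf, hIf⟩ := exists_complement_forms I c
  have hI : ∀ p : MvPolynomial (Fin n) K, p.IsHomogeneous c →
      p ∈ Ideal.span (Set.range u ∪ Set.range f) := by
    intro p hp
    rw [Ideal.span_union, hu.span_eq]
    exact hIf p hp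
  refine ⟨reg_le_add G hS (smulStable_cyclesGrading hS t) (independent_cyclesGrading G t)
    fun a ha => regLE_cyclesGrading hS
      (regLE_cyclePieces G hS ha _ hu.homogeneous hd hnil f hf hI t),
    reg_le_add G hS (smulStable_homologyGrading hS t)
      (independent_homologyGrading G hS hu.homogeneous t)
      fun a ha => regLE_homologyGrading hS
        ((regLE_homologyPieces G hS ha hu.homogeneous hd hnil f hf hI t).mono
          (by linarith))⟩
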